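/- **Setting.** Let $n,p,m_1,\dots,m_n$ be positive integers, $[n]=\{1,\dots,n\}$, and let $\|\cdot\|$ be the Euclidean norm of vectors and the induced 2-norm of matrices. Inequalities between vectors are componentwise, and $[v]_+$ is the componentwise positive part of $v$. Let $\mathbb X\subseteq\mathbb R^p$ be closed and convex, contained in the ball of radius $R$ centred at the origin and containing a ball of positive radius centred at the origin. For each agent $i\in[n]$ and round $t=1,2,\dots$ let $f_{i,t}:\mathbb X\to\mathbb R$ and $g_{i,t}:\mathbb X\to\mathbb R^{m_i}$ be convex (the latter componentwise), with a subgradient $\partial f_{i,t}(x)\in\mathbb R^p$ and a matrix $\partial g_{i,t}(x)\in\mathbb R^{p\times m_i}$ whose $k$-th column is a subgradient of the $k$-th component of $g_{i,t}$, at every $x\in\mathbb X$. Suppose that for all $i$, $t$ and all $x,y\in\mathbb X$ $$|f_{i,t}(x)-f_{i,t}(y)|\le F_1,\quad \|g_{i,t}(x)\|\le F_1,\quad \|\partial f_{i,t}(x)\|\le F_2,\quad \|\partial g_{i,t}(x)\|\le F_2,$$ and that the losses are $\mu$-strongly convex, $\mu>0$: $$f_{i,t}(x)\ge f_{i,t}(y)+\langle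 x-y,\partial f_{i,t}(y)\rangle+\tfrac{\mu}{2}\|x-y\|^2 .$$ Let $\partial[g_{i,t}(x)]_+$ be the matrix obtained from $\partial g_{i,t}(x)$ by replacing with $0$ every column $k$ for which the $k$-th component of $g_{i,t}(x)$ is negative. Put $f_t=\frac1n\sum_{j=1}^nf_{j,t}$, and let $g_t=\mathrm{col}(g_{1,t},\dots,g_{n,t})$ be the stacked constraint function. Suppose that for every $T\ge1$ some $x\in\mathbb X$ satisfies $g_t(x)\le 0$ for $t=1,\dots,T$. The agents communicate over directed graphs $\mathcal G_t=([n],\mathcal E_t)$ with mixing matrices $W_t\in\mathbb R^{n\times n}$, where $[W_t]_{ij}>0$ if $(j,i)\in\mathcal E_t$ or $i=j$, and $[W_t]_{ij}=0$ otherwise. There are $w\in(0,1)$ and an integer $B>0$ such that for all $t\ge1$: every positive entry of $W_t$ is at least $w$, $W_t$ is doubly stochastic, and the graph $([n],\bigcup_{l=0}^{B-1}\mathcal E_{t+l})$ is strongly connected. **Algorithm 1.** Start from any $x_{i,1}\in\mathbb X$ and $q_{i,1}=0\in\mathbb R^{m_i}$. For $t=1,2,\dots$ and every $i\in[n]$ set,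 with $\mathcal P_{\mathbb X}$ the Euclidean projection onto $\mathbb X$, $$z_{i,t+1}=\sum_{j=1}^n[W_t]_{ij}x_{j,t},\qquad \omega_{i,t+1}=\partial f_{i,t}(x_{i,t})+\partial[g_{i,t}(x_{i,t})]_+\,q_{i,t},\qquad x_{i,t+1}=\mathcal P_{\mathbb X}(z_{i,t+1}-\alpha_{t+1}\omega_{i,t+1}),$$ $$q_{i,t+1}=\Big[(1-\beta_{t+1}\gamma_{t+1})q_{i,t}+\gamma_{t+1}\Big([g_{i,t}(x_{i,t})]_++(\partial[g_{i,t}(x_{i,t})]_+)^\top(x_{i,t+1}-x_{i,t})\Big)\Big]_+ .$$ **Theorem.** Let $\kappa\in(0,1)$ and $c\in[\max\{\kappa,1-\kappa\},1)$, and run Algorithm 1 with $\alpha_t=1/t^{c}$, $\beta_t=1/t^{\kappa}$, $\gamma_t=1/t^{1-\kappa}$. There is a constant $C$, depending only on $n$, $(m_i)_{i\in[n]}$, $R$, $F_1$, $F_2$, $\mu$, $w$, $B$, $\kappa$ and $c$, such that for every $T\ge1$ the function $\sum_{t=1}^Tf_t$ has a minimizer on $\{x\in\mathbb X: g_t(x)\le0,\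 t=1,\dots,T\}$, for every such minimizer $\check x_T^*$ the static network regret satisfies $$\frac1n\sum_{i=1}^n\sum_{t=1}^Tf_t(x_{i,t})-\sum_{t=1}^Tf_t(\check x^*_T)\le C\,T^{\kappa},$$ and the network cumulative constraint violation satisfies $$\frac1n\sum_{i=1}^n\sum_{t=1}^T\big\|[g_t(x_{i,t})]_+\big\|\le C\,T^{1-\kappa/2}.$$ -/

import Mathlib

open scoped Matrix.Norms.L2Operator

namespace OnlineOpt

open Classical in
/-- The Euclidean projection of `x` onto `K`: the minimizer of `‖x - y‖ ^ 2` over `y ∈ K`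
(with value `0` if there is none, which does not happen for nonempty closed convex `K`,
see `metricProj_spec`). -/
noncomputable def metricProj {p : ℕ} (K : Set (EuclideanSpace ℝ (Fin p)))
    (x : EuclideanSpace ℝ (Fin p)) : EuclideanSpace ℝ (Fin p) :=
  if h : ∃ y ∈ K, ∀ z ∈ K, ‖x - y‖ ^ 2 ≤ ‖x - z‖ ^ 2 then h.choose else 0

theorem metricProj_spec {p : ℕ} {K : Set (EuclideanSpace ℝ (Fin p))} (hne : K.Nonempty)
    (hcl : IsClosed K) (x : EuclideanSpace ℝ (Fin p)) :
    metricProj K x ∈ K ∧ ∀ z ∈ K, ‖x - metricProj K x‖ ^ 2 ≤ ‖x - z‖ ^ 2 := by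
  have h : ∃ y ∈ K, ∀ z ∈ K, ‖x - y‖ ^ 2 ≤ ‖x - z‖ ^ 2 := by
    obtain ⟨y, hy, hd⟩ := hcl.exists_infDist_eq_dist hne x
    refine ⟨y, hy, fun z hz => ?_⟩
    have h1 : dist x y ≤ dist x z := hd ▸ Metric.infDist_le_dist_of_mem hz
    rw [dist_eq_norm, dist_eq_norm] at h1
    exact pow_le_pow_left₀ (norm_nonneg _) h1 2
  unfold metricProj
  rw [dif_pos h]
  exact h.choose_spec

/-- `[v]_+`, the componentwise positive part, i.e. the Euclidean projection onto the nonnegative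
orthant. -/
noncomputable def posPart {ι : Type*} (v : EuclideanSpace ℝ ι) : EuclideanSpace ℝ ι :=
  WithLp.toLp 2 fun k => max (v k) 0

/-- `v` is a subgradient at `x` of the function `h` with domain `X`. -/
def IsSubgradientOn {p : ℕ} (X : Set (EuclideanSpace ℝ (Fin p)))
    (h : EuclideanSpace ℝ (Fin p) → ℝ) (x v : EuclideanSpace ℝ (Fin p)) : Prop :=
  ∀ y ∈ X, h x + inner ℝ v (y - x) ≤ h y

/-- `∂[g(x)]_+ ∈ ℝ^{p × d}`, computed from the value `gx = g(x) ∈ ℝ^d` and the subgradient matrix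
`J = ∂g(x) ∈ ℝ^{p × d}`: its `k`-th column is `0` if `g_k(x) < 0`, and `∂g_k(x)` otherwise. -/
noncomputable def clipSubgrad {p d : ℕ} (gx : EuclideanSpace ℝ (Fin d))
    (J : Matrix (Fin p) (Fin d) ℝ) : Matrix (Fin p) (Fin d) ℝ :=
  Matrix.of fun a k => if gx k < 0 then 0 else J a k

/-- The data of the distributed online problem with `n` agents, decisions in `ℝ^p`, and `m i`
constraints for agent `i`: the decision set `X`, the local losses `f i t`, the local constraint
functions `g i t`, and the subgradients `df i t x` and `dg i t x` of `f i t` and `g i t` at `x` that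
are revealed to the agents. Column `k` of the matrix `dg i t x` is the subgradient of the `k`-th
component of `g i t`. The rounds are `t = 1, 2, …`, and the functions are meant on `X`;
all other values are irrelevant. -/
structure Problem (n : ℕ) (m : Fin n → ℕ) (p : ℕ) where
  X : Set (EuclideanSpace ℝ (Fin p))
  f : Fin n → ℕ → EuclideanSpace ℝ (Fin p) → ℝ
  g : (i : Fin n) → ℕ → EuclideanSpace ℝ (Fin p) → EuclideanSpace ℝ (Fin (m i))
  df : Fin n → ℕ → EuclideanSpace ℝ (Fin p) → EuclideanSpace ℝ (Fin p)
  dg : (i : Fin n) → ℕ → EuclideanSpace ℝ (Fin p) → Matrix (Fin p) (Fin (m i)) ℝ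

namespace Problem

variable {n : ℕ} {m : Fin n → ℕ} {p : ℕ}

/-- The standing assumption on the decision set, the losses and the constraint functions. The norm
of the matrix `dg i t x` is the induced 2-norm. -/
structure Regular (P : Problem n m p) (R F₁ F₂ : ℝ) : Prop where
  convex : Convex ℝ P.X
  closed : IsClosed P.X
  contains_ball : ∃ r > 0, Metric.closedBall 0 r ⊆ P.X
  subset_ball : P.X ⊆ Metric.closedBall 0 R
  convex_loss : ∀ i, ∀ t ≥ 1, ConvexOn ℝ P.X (P.f i t)
  convex_constraint : ∀ i, ∀ t ≥ 1, ∀ k, ConvexOn ℝ P.X fun x => P.g i t x k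
  loss_bound : ∀ i, ∀ t ≥ 1, ∀ x ∈ P.X, ∀ y ∈ P.X, |P.f i t x - P.f i t y| ≤ F₁
  constraint_bound : ∀ i, ∀ t ≥ 1, ∀ x ∈ P.X, ‖P.g i t x‖ ≤ F₁
  loss_subgrad : ∀ i, ∀ t ≥ 1, ∀ x ∈ P.X, IsSubgradientOn P.X (P.f i t) x (P.df i t x)
  constraint_subgrad : ∀ i, ∀ t ≥ 1, ∀ x ∈ P.X, ∀ k,
    IsSubgradientOn P.X (fun y => P.g i t y k) x (WithLp.toLp 2 fun a => P.dg i t x a k)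
  loss_subgrad_bound : ∀ i, ∀ t ≥ 1, ∀ x ∈ P.X, ‖P.df i t x‖ ≤ F₂
  constraint_subgrad_bound : ∀ i, ∀ t ≥ 1, ∀ x ∈ P.X, ‖P.dg i t x‖ ≤ F₂

/-- All local losses are strongly convex over `X` with parameter `μ`. -/
def StronglyConvex (P : Problem n m p) (μ : ℝ) : Prop :=
  ∀ i, ∀ t ≥ 1, ∀ x ∈ P.X, ∀ y ∈ P.X,
    P.f i t y + inner ℝ (x - y) (P.df i t y) + μ / 2 * ‖x - y‖ ^ 2 ≤ P.f i t x

/-- The global loss `f_t`. -/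
noncomputable def globalLoss (P : Problem n m p) (t : ℕ) (x : EuclideanSpace ℝ (Fin p)) : ℝ :=
  1 / (n : ℝ) * ∑ j, P.f j t x

/-- The global constraint function `g_t = col(g_{1,t}, …, g_{n,t})`. -/
noncomputable def globalConstraint (P : Problem n m p) (t : ℕ) (x : EuclideanSpace ℝ (Fin p)) :
    EuclideanSpace ℝ (Σ i, Fin (m i)) :=
  WithLp.toLp 2 fun s => P.g s.1 t x s.2

/-- The decisions `x ∈ X` with `g_t(x) ≤ 0` for `t = 1, …, T`. -/
def staticFeasible (P : Problem n m p) (T : ℕ) : Set (EuclideanSpace ℝ (Fin p)) :=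
  {x | x ∈ P.X ∧ ∀ t ∈ Finset.Icc 1 T, ∀ s, P.globalConstraint t x s ≤ 0}

/-- `y` is an optimal static decision for the horizon `T`. -/
def IsOptimalStatic (P : Problem n m p) (T : ℕ) (y : EuclideanSpace ℝ (Fin p)) : Prop :=
  y ∈ P.staticFeasible T ∧
    IsMinOn (fun x => ∑ t ∈ Finset.Icc 1 T, P.globalLoss t x) (P.staticFeasible T) y

/-- The network regret of the decisions `x` against the comparator sequence `y`. -/
noncomputable def netReg (P : Problem n m p) (x : Fin n → ℕ → EuclideanSpace ℝ (Fin p))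
    (y : ℕ → EuclideanSpace ℝ (Fin p)) (T : ℕ) : ℝ :=
  1 / (n : ℝ) * ∑ i, ∑ t ∈ Finset.Icc 1 T, P.globalLoss t (x i t)
    - ∑ t ∈ Finset.Icc 1 T, P.globalLoss t (y t)

/-- The network cumulative constraint violation of the decisions `x`. -/
noncomputable def netViolation (P : Problem n m p)
    (x : Fin n → ℕ → EuclideanSpace ℝ (Fin p)) (T : ℕ) : ℝ :=
  1 / (n : ℝ) * ∑ i, ∑ t ∈ Finset.Icc 1 T, ‖posPart (P.globalConstraint t (x i t))‖

/-- `x` and `q` are the primal and dual sequences generated by the full-information algorithm with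
mixing matrices `W` and parameter sequences `α`, `β`, `γ`, from some initial points in `X`. -/
structure IsRun (P : Problem n m p) (W : ℕ → Matrix (Fin n) (Fin n) ℝ) (α β γ : ℕ → ℝ)
    (x : Fin n → ℕ → EuclideanSpace ℝ (Fin p))
    (q : (i : Fin n) → ℕ → EuclideanSpace ℝ (Fin (m i))) : Prop where
  init_primal : ∀ i, x i 1 ∈ P.X
  init_dual : ∀ i, q i 1 = 0
  step_primal : ∀ i, ∀ t ≥ 1,
    let z := ∑ j, W t i j • x j t
    let J := clipSubgrad (P.g i t (x i t)) (P.dg i t (x i t))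
    let ω := P.df i t (x i t) + J.toEuclideanLin (q i t)
    x i (t + 1) = metricProj P.X (z - α (t + 1) • ω)
  step_dual : ∀ i, ∀ t ≥ 1,
    let J := clipSubgrad (P.g i t (x i t)) (P.dg i t (x i t))
    q i (t + 1) = posPart ((1 - β (t + 1) * γ (t + 1)) • q i t
      + γ (t + 1) • (posPart (P.g i t (x i t))
        + J.transpose.toEuclideanLin (x i (t + 1) - x i t)))

end Problem

/-- `W t` is a mixing matrix of the directed communication graph `G t`, where `(G t).Adj j i` means
that agent `i` receives data from agent `j` in round `t`; its positive entries are at least `w`,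
it is doubly stochastic, and the union of the graphs over any `B` consecutive rounds is strongly
connected. -/
structure MixingNetwork {n : ℕ} (G : ℕ → Digraph (Fin n)) (W : ℕ → Matrix (Fin n) (Fin n) ℝ)
    (w : ℝ) (B : ℕ) : Prop where
  pos_of_edge : ∀ t ≥ 1, ∀ i j, (G t).Adj j i ∨ i = j → 0 < W t i j
  zero_of_not_edge : ∀ t ≥ 1, ∀ i j, ¬ ((G t).Adj j i ∨ i = j) → W t i j = 0
  lower_bound : ∀ t ≥ 1, ∀ i j, 0 < W t i j → w ≤ W t i j
  col_sum : ∀ t ≥ 1, ∀ j, ∑ i, W t i j = 1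
  row_sum : ∀ t ≥ 1, ∀ i, ∑ j, W t i j = 1
  connected : ∀ t ≥ 1, ∀ i j,
    Relation.ReflTransGen (fun a b => ∃ l < B, (G (t + l)).Adj a b) i j

end OnlineOpt

/-! Everything follows from one estimate, valid for every feasible `y`, all dual comparators `q₀ i ≥
0` and every `K` with `‖q₀ i‖ ≤ K`: summed over agents and rounds, the loss gap to `y` plus `⟪q₀ i,
[g_i]_+⟫` plus `K` times the disagreement is at most `A (K² T^(1-κ) + T^κ)`
(`regret_add_violation_le_rpow`). Taking `q₀ = 0`, `K = 0` gives the regret bound. For the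
violation, `q₀` is a constant positive vector and `K = T^(κ/2)`, so the right side is `O(T)`; the
loss gap is at least a negative multiple of `T`, and division by `K` leaves `T^(1-κ/2)`. The
disagreement term turns the violation of each agent's own constraint into that of the stacked one.

For one agent (`agent_step`), a projected subgradient inequality with comparator `y` is added to a
dual ascent inequality with comparator `q₀`. The coupling through `q i t` drops out because the
linearized positive part is nonpositive at a feasible `y`. Since `β_t γ_t = 1/t`, the dual variable
is `O(t^κ)`, so `β q` stays bounded and the squared dual steps cost only a multiple of `∑ γ_t =
O(T^κ)`. The primal weights `t^c` grow, so the distances to `y` do not telescope exactly, but the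
increments of `t^c` tend to zero and eventually fall below `μ`: strong convexity absorbs all but a
bounded amount.

Across agents, mixing contracts the diameter of the decisions over `n * B` rounds, so the total
disagreement is at most a constant plus a multiple of the total displacement `‖x i (t+1) - z‖` from
the mixed points `z` (`sum_spread_le`). The proximal term `-(t+1)^c/2 ‖x i (t+1) - z‖²` left by the
projection absorbs these displacements by Young's inequality, at cost `∑ α_t = O(T^(1-c))`. The
condition `c ≥ max κ (1-κ)` makes this cost harmless. -/

namespace OnlineOpt

/-! ### Projections, positive parts and operator norms -/

section Basics

variable {p d : ℕ}

/-- The Pythagorean inequality for the projection onto a closed convex set. -/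
theorem norm_metricProj_sub_sq_le {K : Set (EuclideanSpace ℝ (Fin p))} (hK : Convex ℝ K)
    (hcl : IsClosed K) (u : EuclideanSpace ℝ (Fin p)) {y : EuclideanSpace ℝ (Fin p)}
    (hy : y ∈ K) :
    ‖metricProj K u - y‖ ^ 2 ≤ ‖u - y‖ ^ 2 - ‖u - metricProj K u‖ ^ 2 := by
  have hne : K.Nonempty := ⟨y, hy⟩
  obtain ⟨hv, hmin⟩ := metricProj_spec hne hcl u
  set v := metricProj K u
  have : Nonempty K := hne.to_subtype
  have hinf : ‖u - v‖ = ⨅ w : K, ‖u - w‖ := by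
    apply le_antisymm
    · exact le_ciInf fun w => le_of_sq_le_sq (hmin w w.2) (norm_nonneg _)
    · exact ciInf_le ⟨0, by rintro _ ⟨w, rfl⟩; exact norm_nonneg _⟩ (⟨v, hv⟩ : K)
  have hin := (norm_eq_iInf_iff_real_inner_le_zero hK hv).1 hinf y hy
  have h1 : u - y = (u - v) - (y - v) := by abel
  rw [h1, norm_sub_rev v y, norm_sub_sq_real (u - v) (y - v)]
  linarith

theorem posPart_apply {ι : Type*} (v : EuclideanSpace ℝ ι) (k : ι) :
    posPart v k = max (v k) 0 := rfl

theorem posPart_nonneg {ι : Type*} (v : EuclideanSpace ℝ ι) (k : ι) : 0 ≤ posPart v k :=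
  le_max_right _ _

theorem norm_le_norm_of_abs_le {ι : Type*} [Fintype ι] {u v : EuclideanSpace ℝ ι}
    (h : ∀ k, |u k| ≤ |v k|) : ‖u‖ ≤ ‖v‖ := by
  apply le_of_sq_le_sq _ (norm_nonneg _)
  rw [EuclideanSpace.real_norm_sq_eq, EuclideanSpace.real_norm_sq_eq]
  exact Finset.sum_le_sum fun k _ => sq_le_sq.2 (h k)

theorem norm_posPart_sub_le {ι : Type*} [Fintype ι] (v : EuclideanSpace ℝ ι)
    {q : EuclideanSpace ℝ ι} (hq : ∀ k, 0 ≤ q k) : ‖posPart v - q‖ ≤ ‖v - q‖ := by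
  refine norm_le_norm_of_abs_le fun k => ?_
  have := hq k
  simp only [PiLp.sub_apply, posPart_apply]
  rcases le_total (v k) 0 with h | h
  · rw [max_eq_right h, abs_of_nonpos (by linarith), abs_of_nonpos (by linarith)]; linarith
  · rw [max_eq_left h]

theorem norm_posPart_le {ι : Type*} [Fintype ι] (v : EuclideanSpace ℝ ι) :
    ‖posPart v‖ ≤ ‖v‖ := by
  simpa using norm_posPart_sub_le v (q := 0) (by simp)

theorem norm_le_sum_abs {ι : Type*} [Fintype ι] (v : EuclideanSpace ℝ ι) :
    ‖v‖ ≤ ∑ k, |v k| := by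
  classical
  have h : v = ∑ k, EuclideanSpace.single k (v k) := by
    ext j
    simp [Finset.sum_apply]
  calc ‖v‖ = ‖∑ k, EuclideanSpace.single k (v k)‖ := by rw [← h]
    _ ≤ ∑ k, ‖EuclideanSpace.single k (v k)‖ := norm_sum_le _ _
    _ = _ := by simp

/-- In this form, submultiplicativity shows that clipping does not increase the operator norm. -/
theorem clipSubgrad_eq_mul (gx : EuclideanSpace ℝ (Fin d)) (J : Matrix (Fin p) (Fin d) ℝ) :
    clipSubgrad gx J = J * Matrix.diagonal fun k => if gx k < 0 then (0 : ℝ) else 1 := by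
  ext a k
  rw [Matrix.mul_diagonal]
  simp [clipSubgrad]

theorem norm_clipSubgrad_le (gx : EuclideanSpace ℝ (Fin d)) (J : Matrix (Fin p) (Fin d) ℝ) :
    ‖clipSubgrad gx J‖ ≤ ‖J‖ := by
  rw [clipSubgrad_eq_mul]
  refine (Matrix.l2_opNorm_mul _ _).trans ?_
  rw [Matrix.l2_opNorm_diagonal]
  refine mul_le_of_le_one_right (norm_nonneg _) ?_
  rw [pi_norm_le_iff_of_nonneg zero_le_one]
  intro k
  split_ifs <;> simp

theorem norm_toEuclideanLin_le (A : Matrix (Fin p) (Fin d) ℝ) (v : EuclideanSpace ℝ (Fin d)) :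
    ‖A.toEuclideanLin v‖ ≤ ‖A‖ * ‖v‖ := by
  exact Matrix.l2_opNorm_mulVec A v

theorem norm_transpose (A : Matrix (Fin p) (Fin d) ℝ) : ‖A.transpose‖ = ‖A‖ := by
  rw [← Matrix.conjTranspose_eq_transpose_of_trivial, Matrix.l2_opNorm_conjTranspose]

theorem inner_toEuclideanLin (A : Matrix (Fin p) (Fin d) ℝ) (v : EuclideanSpace ℝ (Fin d))
    (u : EuclideanSpace ℝ (Fin p)) :
    inner ℝ (A.toEuclideanLin v) u = inner ℝ v (A.transpose.toEuclideanLin u) := by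
  rw [← Matrix.conjTranspose_eq_transpose_of_trivial,
    Matrix.toEuclideanLin_conjTranspose_eq_adjoint, LinearMap.adjoint_inner_right]

theorem toEuclideanLin_transpose_apply (A : Matrix (Fin p) (Fin d) ℝ)
    (u : EuclideanSpace ℝ (Fin p)) (k : Fin d) :
    A.transpose.toEuclideanLin u k = inner ℝ (WithLp.toLp 2 fun a => A a k) u := by
  rw [EuclideanSpace.inner_eq_star_dotProduct]
  simp [Matrix.toLpLin_apply, Matrix.mulVec, dotProduct, mul_comm]

theorem inner_le_inner_of_le {ι : Type*} [Fintype ι] {q u v : EuclideanSpace ℝ ι}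
    (hq : ∀ k, 0 ≤ q k) (h : ∀ k, u k ≤ v k) : (inner ℝ q u : ℝ) ≤ inner ℝ q v := by
  simp only [PiLp.inner_apply, RCLike.inner_apply, conj_trivial]
  exact Finset.sum_le_sum fun k _ => mul_le_mul_of_nonneg_right (h k) (hq k)

theorem norm_col_le (A : Matrix (Fin p) (Fin d) ℝ) (k : Fin d) :
    ‖(WithLp.toLp 2 fun a => A a k : EuclideanSpace ℝ (Fin p))‖ ≤ ‖A‖ := by
  have h := norm_toEuclideanLin_le A (EuclideanSpace.single k 1)
  have h2 : A.toEuclideanLin (EuclideanSpace.single k 1) = WithLp.toLp 2 fun a => A a k := by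
    ext a
    simp [Matrix.toLpLin_apply]
  rw [h2] at h
  simpa using h

/-- The norm of a stacked vector is at most the sum of the norms of its blocks. -/
theorem norm_le_sum_norm_blocks {n : ℕ} {m : Fin n → ℕ}
    (v : EuclideanSpace ℝ (Σ i, Fin (m i))) :
    ‖v‖ ≤ ∑ i, ‖(WithLp.toLp 2 fun k => v ⟨i, k⟩ : EuclideanSpace ℝ (Fin (m i)))‖ := by
  apply le_of_sq_le_sq _ (Finset.sum_nonneg fun i _ => norm_nonneg _)
  rw [EuclideanSpace.real_norm_sq_eq, Fintype.sum_sigma]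
  refine le_trans (le_of_eq ?_) (Finset.sum_sq_le_sq_sum_of_nonneg fun i _ => norm_nonneg _)
  refine Finset.sum_congr rfl fun i _ => ?_
  rw [EuclideanSpace.real_norm_sq_eq]

end Basics

/-! ### Consensus over jointly connected graphs -/

section Consensus

variable {n : ℕ} {E : Type*} [NormedAddCommGroup E] [NormedSpace ℝ E]

theorem norm_sum_smul_le {a : Fin n → ℝ} (ha : ∀ i, 0 ≤ a i) (hs : ∑ i, a i = 1)
    {v : Fin n → E} {D : ℝ} (hv : ∀ i, ‖v i‖ ≤ D) : ‖∑ i, a i • v i‖ ≤ D := by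
  calc ‖∑ i, a i • v i‖ ≤ ∑ i, ‖a i • v i‖ := norm_sum_le _ _
    _ ≤ ∑ i, a i * D := Finset.sum_le_sum fun i _ => by
        rw [norm_smul, Real.norm_of_nonneg (ha i)]
        exact mul_le_mul_of_nonneg_left (hv i) (ha i)
    _ = D := by rw [← Finset.sum_mul, hs, one_mul]

/-- Averaging with weights that are all at least `η` contracts the diameter. -/
theorem norm_sum_smul_sub_sum_smul_le {a b : Fin n → ℝ} {η D : ℝ} (hn : 0 < n)
    (hη : 0 ≤ η) (ha : ∀ i, η ≤ a i) (hb : ∀ i, η ≤ b i) (has : ∑ i, a i = 1)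
    (hbs : ∑ i, b i = 1) {v : Fin n → E} (hv : ∀ i j, ‖v i - v j‖ ≤ D) :
    ‖∑ i, a i • v i - ∑ i, b i • v i‖ ≤ (1 - η) * D := by
  have hD : 0 ≤ D := (norm_nonneg _).trans (hv ⟨0, hn⟩ ⟨0, hn⟩)
  set s : ℝ := 1 - n * η with hs
  have hsa : ∑ i, (a i - η) = s := by
    rw [Finset.sum_sub_distrib, has]; simp [hs]
  have hsb : ∑ i, (b i - η) = s := by
    rw [Finset.sum_sub_distrib, hbs]; simp [hs]
  have hs0 : 0 ≤ s := by rw [← hsa]; exact Finset.sum_nonneg fun i _ => sub_nonneg.2 (ha i)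
  have hn1 : (1 : ℝ) ≤ n := by exact_mod_cast hn
  have hs1 : s ≤ 1 - η := by rw [hs]; nlinarith
  -- After `η` is removed from every weight, both families have the same mass `s`. Scaling by `s`
  -- makes the difference a double sum of pairwise differences, of total weight `s²`.
  have key : s • (∑ i, a i • v i - ∑ i, b i • v i)
      = ∑ i, ∑ j, ((a i - η) * (b j - η)) • (v i - v j) := by
    have e1 : ∑ i, ∑ j, ((a i - η) * (b j - η)) • v i = s • ∑ i, (a i - η) • v i := by
      rw [Finset.smul_sum]
      refine Finset.sum_congr rfl fun i _ => ?_
      rw [← Finset.sum_smul, ← Finset.mul_sum, hsb, mul_smul, smul_comm]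
    have e2 : ∑ i, ∑ j, ((a i - η) * (b j - η)) • v j = s • ∑ i, (b i - η) • v i := by
      rw [Finset.sum_comm, Finset.smul_sum]
      refine Finset.sum_congr rfl fun i _ => ?_
      rw [← Finset.sum_smul, ← Finset.sum_mul, hsa, mul_smul]
    simp only [smul_sub, Finset.sum_sub_distrib]
    rw [e1, e2]
    simp only [sub_smul, Finset.sum_sub_distrib, smul_sub]
    abel
  have hbound : s * ‖∑ i, a i • v i - ∑ i, b i • v i‖ ≤ s * (s * D) := by
    rw [← Real.norm_of_nonneg hs0, ← norm_smul, key, Real.norm_of_nonneg hs0]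
    calc _ ≤ ∑ i, ∑ j, ‖((a i - η) * (b j - η)) • (v i - v j)‖ :=
          (norm_sum_le _ _).trans (Finset.sum_le_sum fun i _ => norm_sum_le _ _)
      _ ≤ ∑ i, ∑ j, (a i - η) * (b j - η) * D := by
          refine Finset.sum_le_sum fun i _ => Finset.sum_le_sum fun j _ => ?_
          have h0 := mul_nonneg (sub_nonneg.2 (ha i)) (sub_nonneg.2 (hb j))
          rw [norm_smul, Real.norm_of_nonneg h0]
          exact mul_le_mul_of_nonneg_left (hv i j) h0
      _ = s * (s * D) := by
          simp only [← Finset.sum_mul, ← Finset.mul_sum, hsa, hsb]; ring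
  -- If `s = 0`, nothing can be cancelled, but then all weights equal `η` and the two averages
  -- coincide.
  rcases hs0.eq_or_lt with h0 | h0
  · have hza : ∀ i, a i = η := by
      intro i
      have := (Finset.sum_eq_zero_iff_of_nonneg fun i _ => sub_nonneg.2 (ha i)).1
        (hsa.trans h0.symm) i (Finset.mem_univ _)
      linarith
    have hzb : ∀ i, b i = η := by
      intro i
      have := (Finset.sum_eq_zero_iff_of_nonneg fun i _ => sub_nonneg.2 (hb i)).1
        (hsb.trans h0.symm) i (Finset.mem_univ _)
      linarith
    simp only [hza, hzb, sub_self, norm_zero]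
    exact mul_nonneg (by linarith) hD
  · exact (le_of_mul_le_mul_left hbound h0).trans (mul_le_mul_of_nonneg_right hs1 hD)

/-- The product `W (t + k - 1) ⋯ W t`. -/
noncomputable def transition (W : ℕ → Matrix (Fin n) (Fin n) ℝ) (t : ℕ) :
    ℕ → Matrix (Fin n) (Fin n) ℝ
  | 0 => 1
  | k + 1 => W (t + k) * transition W t k

variable {G : ℕ → Digraph (Fin n)} {W : ℕ → Matrix (Fin n) (Fin n) ℝ} {w : ℝ} {B : ℕ}

namespace MixingNetwork

theorem nonneg (h : MixingNetwork G W w B) {t : ℕ} (ht : 1 ≤ t) (i j : Fin n) :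
    0 ≤ W t i j := by
  by_cases he : (G t).Adj j i ∨ i = j
  · exact (h.pos_of_edge t ht i j he).le
  · exact (h.zero_of_not_edge t ht i j he).ge

theorem le_of_edge (h : MixingNetwork G W w B) {t : ℕ} (ht : 1 ≤ t) {i j : Fin n}
    (he : (G t).Adj j i ∨ i = j) : w ≤ W t i j :=
  h.lower_bound t ht i j (h.pos_of_edge t ht i j he)

theorem transition_nonneg (h : MixingNetwork G W w B) {t : ℕ} (ht : 1 ≤ t) (k : ℕ)
    (i j : Fin n) : 0 ≤ transition W t k i j := by
  induction k generalizing i with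
  | zero => simp only [transition, Matrix.one_apply]; split_ifs <;> simp
  | succ k ih =>
    simp only [transition, Matrix.mul_apply]
    exact Finset.sum_nonneg fun l _ => mul_nonneg (h.nonneg (by omega) _ _) (ih l)

theorem transition_row_sum (h : MixingNetwork G W w B) {t : ℕ} (ht : 1 ≤ t) (k : ℕ)
    (i : Fin n) : ∑ j, transition W t k i j = 1 := by
  induction k generalizing i with
  | zero => simp [transition, Matrix.one_apply]
  | succ k ih =>
    simp only [transition, Matrix.mul_apply]
    rw [Finset.sum_comm]
    simp only [← Finset.mul_sum, ih, mul_one]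
    exact h.row_sum _ (by omega) i

theorem mul_transition_le (h : MixingNetwork G W w B) {t : ℕ} (ht : 1 ≤ t) (k : ℕ)
    (i l j : Fin n) : W (t + k) i l * transition W t k l j ≤ transition W t (k + 1) i j := by
  simp only [transition, Matrix.mul_apply]
  exact Finset.single_le_sum (f := fun l => W (t + k) i l * transition W t k l j)
    (fun l _ => mul_nonneg (h.nonneg (by omega) _ _) (h.transition_nonneg ht k l j))
    (Finset.mem_univ l)

theorem pow_succ_le_transition (h : MixingNetwork G W w B) (hw : 0 < w) {t : ℕ} (ht : 1 ≤ t)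
    {k : ℕ} {i l j : Fin n} (he : (G (t + k)).Adj l i ∨ i = l)
    (hl : w ^ k ≤ transition W t k l j) : w ^ (k + 1) ≤ transition W t (k + 1) i j := by
  refine le_trans ?_ (h.mul_transition_le ht k i l j)
  rw [pow_succ']
  exact mul_le_mul (h.le_of_edge (by omega) he) hl (by positivity) (h.nonneg (by omega) _ _)

/-- After `n * B` rounds every agent has a share of at least `w ^ (n * B)` in every other. -/
theorem pow_le_transition (h : MixingNetwork G W w B) (hw : 0 < w) {t : ℕ} (ht : 1 ≤ t)
    (i j : Fin n) : w ^ (n * B) ≤ transition W t (n * B) i j := by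
  classical
  -- `S k` holds the agents that the information of `j` has reached with weight at least `w ^ k`
  -- after `k` rounds. Self-loops make it monotone.
  let S : ℕ → Finset (Fin n) := fun k => {i | w ^ k ≤ transition W t k i j}
  have hS : ∀ k i, i ∈ S k ↔ w ^ k ≤ transition W t k i j := fun k i => by simp [S]
  have hmono : Monotone S := monotone_nat_of_le_succ fun k i hi =>
    (hS _ _).2 (h.pow_succ_le_transition hw ht (Or.inr rfl) ((hS _ _).1 hi))
  have hj : ∀ k, j ∈ S k := fun k => hmono (Nat.zero_le k) ((hS _ _).2 (by
    simp [transition]))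
  have hgrow : ∀ k, S k = Finset.univ ∨ (S k).card < (S (k + B)).card := by
    intro k
    by_contra! hcon
    obtain ⟨hne, hcard⟩ := hcon
    have heq : S k = S (k + B) :=
      Finset.eq_of_subset_of_card_le (hmono (Nat.le_add_right _ _)) hcard
    -- If `S` stalls over `B` rounds, it is closed under every edge used in that window, hence
    -- contains everything reachable from `j`.
    refine hne (Finset.eq_univ_iff_forall.2 fun b => ?_)
    have hpath := h.connected (t + k) (by omega) j b
    induction hpath with
    | refl => exact hj k
    | tail _ hab ih =>
      obtain ⟨l, hl, hadj⟩ := hab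
      rw [heq]
      refine hmono (show k + l + 1 ≤ k + B by omega) ((hS _ _).2 ?_)
      refine h.pow_succ_le_transition hw ht (Or.inl ?_)
        ((hS _ _).1 (hmono (Nat.le_add_right k l) ih))
      rwa [← add_assoc]
  have hcard : ∀ r, S (r * B) = Finset.univ ∨ r ≤ (S (r * B)).card := by
    intro r
    induction r with
    | zero => right; simp
    | succ r ih =>
      have hm : S (r * B) ⊆ S ((r + 1) * B) :=
        hmono (Nat.mul_le_mul_right _ (Nat.le_succ r))
      rcases ih with ih | ih
      · left; rw [ih] at hm; exact Finset.univ_subset_iff.1 hm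
      · rcases hgrow (r * B) with hg | hg
        · left; rw [hg] at hm; exact Finset.univ_subset_iff.1 hm
        · right
          rw [add_mul, one_mul]
          omega
  have hfull : S (n * B) = Finset.univ := by
    rcases hcard n with hc | hc
    · exact hc
    · refine Finset.eq_univ_of_card _ (le_antisymm ?_ (by simpa using hc))
      exact Finset.card_le_univ _
  exact (hS _ _).1 (hfull ▸ Finset.mem_univ i)

end MixingNetwork

/-- The diameter of a finite family of points. -/
noncomputable def spread {F : Type*} [NormedAddCommGroup F] (x : Fin n → F) : ℝ := Metric.diam (Set.range x)

theorem norm_sub_le_spread {F : Type*} [NormedAddCommGroup F] (x : Fin n → F) (i j : Fin n) : ‖x i - x j‖ ≤ spread x := by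
  rw [← dist_eq_norm]
  exact Metric.dist_le_diam_of_mem (Set.finite_range x).isBounded ⟨i, rfl⟩ ⟨j, rfl⟩

theorem spread_nonneg {F : Type*} [NormedAddCommGroup F] (x : Fin n → F) : 0 ≤ spread x := Metric.diam_nonneg

theorem spread_le {F : Type*} [NormedAddCommGroup F] {x : Fin n → F} {D : ℝ} (hD : 0 ≤ D)
    (h : ∀ i j, ‖x i - x j‖ ≤ D) :
    spread x ≤ D := by
  refine Metric.diam_le_of_forall_dist_le hD ?_
  rintro _ ⟨i, rfl⟩ _ ⟨j, rfl⟩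
  rw [dist_eq_norm]
  exact h i j

namespace MixingNetwork

/-- A perturbation made in one round is only averaged in later rounds, so its norm never grows and
the errors simply add up. -/
theorem norm_sub_transition_le (h : MixingNetwork G W w B) {t : ℕ} (ht : 1 ≤ t)
    {x : Fin n → ℕ → E} {e : ℕ → ℝ}
    (hx : ∀ s ≥ 1, ∀ i, ‖x i (s + 1) - ∑ j, W s i j • x j s‖ ≤ e s) (k : ℕ) (i : Fin n) :
    ‖x i (t + k) - ∑ j, transition W t k i j • x j t‖ ≤ ∑ s ∈ Finset.range k, e (t + s) := by
  induction k generalizing i with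
  | zero => simp [transition, Matrix.one_apply]
  | succ k ih =>
    have e1 : ∑ j, transition W t (k + 1) i j • x j t
        = ∑ l, W (t + k) i l • ∑ j, transition W t k l j • x j t := by
      simp only [transition, Matrix.mul_apply, Finset.sum_smul, Finset.smul_sum, mul_smul]
      rw [Finset.sum_comm]
    have e2 : x i (t + (k + 1)) - ∑ j, transition W t (k + 1) i j • x j t
        = ∑ l, W (t + k) i l • (x l (t + k) - ∑ j, transition W t k l j • x j t)
          + (x i (t + k + 1) - ∑ j, W (t + k) i j • x j (t + k)) := by
      rw [e1]
      simp only [smul_sub, Finset.sum_sub_distrib, add_assoc]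
      abel
    rw [e2, Finset.sum_range_succ]
    exact (norm_add_le _ _).trans (add_le_add
      (norm_sum_smul_le (h.nonneg (by omega) i) (h.row_sum _ (by omega) i) fun l => ih l)
      (hx _ (by omega) i))

/-- Over `n * B` rounds the disagreement contracts, up to the accumulated perturbations. -/
theorem spread_add_le (h : MixingNetwork G W w B) (hn : 0 < n) (hw : 0 < w) {t : ℕ}
    (ht : 1 ≤ t) {x : Fin n → ℕ → E} {e : ℕ → ℝ}
    (hx : ∀ s ≥ 1, ∀ i, ‖x i (s + 1) - ∑ j, W s i j • x j s‖ ≤ e s) :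
    spread (fun i => x i (t + n * B))
      ≤ (1 - w ^ (n * B)) * spread (fun i => x i t)
        + 2 * ∑ s ∈ Finset.range (n * B), e (t + s) := by
  have key : ∀ i j, ‖x i (t + n * B) - x j (t + n * B)‖
      ≤ (1 - w ^ (n * B)) * spread (fun i => x i t)
        + 2 * ∑ s ∈ Finset.range (n * B), e (t + s) := by
    intro i j
    have h1 := h.norm_sub_transition_le ht hx (n * B) i
    have h2 := h.norm_sub_transition_le ht hx (n * B) j
    have h3 := norm_sum_smul_sub_sum_smul_le hn (by positivity)
      (h.pow_le_transition hw ht i) (h.pow_le_transition hw ht j)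
      (h.transition_row_sum ht _ i) (h.transition_row_sum ht _ j)
      (norm_sub_le_spread fun i => x i t)
    set A := ∑ l, transition W t (n * B) i l • x l t
    set A' := ∑ l, transition W t (n * B) j l • x l t
    have e1 : x i (t + n * B) - x j (t + n * B)
        = (x i (t + n * B) - A) + (A - A') - (x j (t + n * B) - A') := by abel
    rw [e1]
    have h4 := norm_sub_le ((x i (t + n * B) - A) + (A - A')) (x j (t + n * B) - A')
    have h5 := norm_add_le (x i (t + n * B) - A) (A - A')
    linarith
  exact spread_le ((norm_nonneg _).trans (key ⟨0, hn⟩ ⟨0, hn⟩)) key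

/-- The total disagreement is controlled by the total size of the perturbations. -/
theorem sum_spread_le (h : MixingNetwork G W w B) (hn : 0 < n) (hw : 0 < w)
    {x : Fin n → ℕ → E} {e : ℕ → ℝ} (he : ∀ s ≥ 1, 0 ≤ e s)
    (hx : ∀ s ≥ 1, ∀ i, ‖x i (s + 1) - ∑ j, W s i j • x j s‖ ≤ e s) {D : ℝ} (hD : 0 ≤ D)
    (hxD : ∀ t ≥ 1, ∀ i j, ‖x i t - x j t‖ ≤ D) (T : ℕ) :
    w ^ (n * B) * ∑ t ∈ Finset.Icc 1 T, spread (fun i => x i t)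
      ≤ n * B * (D + 2 * ∑ t ∈ Finset.Icc 1 T, e t) := by
  set L := n * B with hL
  set s : ℕ → ℝ := fun t => spread (fun i => x i t) with hs
  have hs0 : ∀ t, 0 ≤ s t := fun t => spread_nonneg _
  have hsD : ∀ t ≥ 1, s t ≤ D := fun t ht => spread_le hD (hxD t ht)
  have hcast : (n * B : ℝ) = L := by rw [hL]; push_cast; ring
  rw [hcast]
  -- The first `L` rounds are paid for by the diameter bound `D`; each later round is compared with
  -- the one `L` earlier, and the contracted sum is finally moved to the left.
  have hshift : ∑ t ∈ Finset.Icc 1 T, s t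
      ≤ L * D + ∑ t ∈ Finset.Icc 1 (T - L), s (t + L) := by
    have hsub : Finset.Icc 1 T ⊆ Finset.Icc 1 L ∪ (Finset.Icc 1 (T - L)).map
        (addRightEmbedding L) := by
      intro t ht
      simp only [Finset.mem_Icc, Finset.mem_union, Finset.mem_map, addRightEmbedding_apply]
        at ht ⊢
      by_cases htL : t ≤ L
      · exact Or.inl ⟨ht.1, htL⟩
      · exact Or.inr ⟨t - L, by omega, by omega⟩
    refine (Finset.sum_le_sum_of_subset_of_nonneg hsub fun t _ _ => hs0 t).trans ?_
    have hun := Finset.sum_union_inter (s₁ := Finset.Icc 1 L)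
      (s₂ := (Finset.Icc 1 (T - L)).map (addRightEmbedding L)) (f := s)
    have hint : 0 ≤ ∑ t ∈ Finset.Icc 1 L ∩ (Finset.Icc 1 (T - L)).map
        (addRightEmbedding L), s t := Finset.sum_nonneg fun t _ => hs0 t
    have h1 : ∑ t ∈ Finset.Icc 1 L, s t ≤ L * D := by
      refine (Finset.sum_le_card_nsmul _ _ D fun t ht => hsD t (Finset.mem_Icc.1 ht).1).trans ?_
      simp
    rw [Finset.sum_map] at hun
    simp only [addRightEmbedding_apply] at hun
    linarith
  have hstep : ∑ t ∈ Finset.Icc 1 (T - L), s (t + L)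
      ≤ (1 - w ^ L) * ∑ t ∈ Finset.Icc 1 (T - L), s t
        + 2 * (L * ∑ t ∈ Finset.Icc 1 T, e t) := by
    refine (Finset.sum_le_sum fun t ht =>
      h.spread_add_le hn hw (Finset.mem_Icc.1 ht).1 hx).trans ?_
    rw [Finset.sum_add_distrib, ← Finset.mul_sum, ← Finset.mul_sum, Finset.sum_comm]
    have : ∑ k ∈ Finset.range L, ∑ t ∈ Finset.Icc 1 (T - L), e (t + k)
        ≤ L * ∑ t ∈ Finset.Icc 1 T, e t := by
      refine (Finset.sum_le_card_nsmul _ _ (∑ t ∈ Finset.Icc 1 T, e t) fun k hk => ?_).trans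
        (by simp)
      refine (Finset.sum_map (Finset.Icc 1 (T - L)) (addRightEmbedding k) e).ge.trans ?_
      refine Finset.sum_le_sum_of_subset_of_nonneg ?_ fun t ht _ => he t (Finset.mem_Icc.1 ht).1
      intro t ht
      simp only [Finset.mem_map, addRightEmbedding_apply, Finset.mem_Icc] at ht ⊢
      have := Finset.mem_range.1 hk
      obtain ⟨a, ha, rfl⟩ := ht
      omega
    linarith
  -- An entry of a stochastic matrix is at most one, and `w ^ L` bounds such an entry from below.
  have hw1 : w ^ L ≤ 1 := by
    have h1 := h.transition_row_sum (le_refl 1) L ⟨0, hn⟩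
    rw [← h1]
    exact (h.pow_le_transition hw le_rfl ⟨0, hn⟩ ⟨0, hn⟩).trans
      (Finset.single_le_sum (f := fun j => transition W 1 L ⟨0, hn⟩ j)
        (fun j _ => h.transition_nonneg le_rfl L _ j) (Finset.mem_univ _))
  have hsubs : ∑ t ∈ Finset.Icc 1 (T - L), s t ≤ ∑ t ∈ Finset.Icc 1 T, s t :=
    Finset.sum_le_sum_of_subset_of_nonneg
      (Finset.Icc_subset_Icc_right (Nat.sub_le _ _)) fun t _ _ => hs0 t
  have := mul_le_mul_of_nonneg_left hsubs (sub_nonneg.2 hw1)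
  linarith

end MixingNetwork

end Consensus

/-! ### Sums and increments of powers -/

section PowerSums

theorem rpow_add_one_sub_le {c t : ℝ} (hc0 : 0 ≤ c) (hc1 : c ≤ 1) (ht : 0 < t) :
    (t + 1) ^ c - t ^ c ≤ c * t ^ (c - 1) := by
  have h := rpow_one_add_le_one_add_mul_self (s := 1 / t) (by have : 0 < 1 / t := by positivity
                                                              linarith) hc0 hc1
  have e1 : (t + 1) ^ c = t ^ c * (1 + 1 / t) ^ c := by
    rw [← Real.mul_rpow ht.le (by positivity)]
    congr 1
    field_simp
  rw [e1, Real.rpow_sub_one ht.ne']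
  have := mul_le_mul_of_nonneg_left h (Real.rpow_nonneg ht.le c)
  have e2 : t ^ c * (1 + c * (1 / t)) = t ^ c + c * (t ^ c / t) := by ring
  linarith

/-- Bernoulli's inequality, applied backwards from `t + 1`, is a discrete substitute for comparing a
sum of powers with an integral. -/
theorem mul_rpow_le_rpow_add_one_sub {s t : ℝ} (hs0 : 0 ≤ s) (hs1 : s ≤ 1) (ht : 0 ≤ t) :
    s * (t + 1) ^ (s - 1) ≤ (t + 1) ^ s - t ^ s := by
  have h1 : 0 < t + 1 := by linarith
  have h2 : 1 / (t + 1) ≤ 1 := by rw [div_le_one h1]; linarith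
  have h := rpow_one_add_le_one_add_mul_self (s := -(1 / (t + 1))) (by linarith) hs0 hs1
  have e1 : t ^ s = (t + 1) ^ s * (1 + -(1 / (t + 1))) ^ s := by
    rw [← Real.mul_rpow h1.le (by linarith)]
    congr 1
    field_simp
    ring
  rw [e1, Real.rpow_sub_one h1.ne']
  have := mul_le_mul_of_nonneg_left h (Real.rpow_nonneg h1.le s)
  have e2 : (t + 1) ^ s * (1 + s * -(1 / (t + 1))) = (t + 1) ^ s - s * ((t + 1) ^ s / (t + 1)) := by
    ring
  linarith

theorem sum_one_div_rpow_le {a : ℝ} (ha0 : 0 ≤ a) (ha1 : a < 1) {T : ℕ} (hT : 1 ≤ T) :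
    ∑ t ∈ Finset.Icc 1 T, 1 / ((t + 1 : ℕ) : ℝ) ^ a ≤ 2 / (1 - a) * (T : ℝ) ^ (1 - a) := by
  have hs : 0 < 1 - a := by linarith
  have h : ∀ N : ℕ, (1 - a) * ∑ t ∈ Finset.Icc 1 N, 1 / ((t + 1 : ℕ) : ℝ) ^ a
      ≤ ((N : ℝ) + 1) ^ (1 - a) := by
    intro N
    induction N with
    | zero => simp
    | succ N ih =>
      rw [Finset.sum_Icc_succ_top (by omega), mul_add]
      have := mul_rpow_le_rpow_add_one_sub (s := 1 - a) (t := (N : ℝ) + 1) hs.le (by linarith)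
        (by positivity)
      have e : (1 - a) * (1 / ((N + 1 + 1 : ℕ) : ℝ) ^ a)
          = (1 - a) * ((N : ℝ) + 1 + 1) ^ (1 - a - 1) := by
        rw [show 1 - a - 1 = -a by ring, Real.rpow_neg (by positivity)]
        push_cast
        rw [one_div]
      rw [e]
      push_cast at ih ⊢
      linarith
  have hT' : (1 : ℝ) ≤ T := by exact_mod_cast hT
  have h2 : ((T : ℝ) + 1) ^ (1 - a) ≤ 2 * (T : ℝ) ^ (1 - a) := by
    calc ((T : ℝ) + 1) ^ (1 - a) ≤ (2 * (T : ℝ)) ^ (1 - a) :=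
          Real.rpow_le_rpow (by positivity) (by linarith) hs.le
      _ = 2 ^ (1 - a) * (T : ℝ) ^ (1 - a) := Real.mul_rpow (by norm_num) (by positivity)
      _ ≤ 2 * (T : ℝ) ^ (1 - a) := by
          refine mul_le_mul_of_nonneg_right ?_ (by positivity)
          calc (2 : ℝ) ^ (1 - a) ≤ 2 ^ (1 : ℝ) :=
                Real.rpow_le_rpow_of_exponent_le (by norm_num) (by linarith)
            _ = 2 := Real.rpow_one 2
  have h3 := (h T).trans h2
  rw [div_mul_eq_mul_div, le_div_iff₀ hs]
  linarith

/-- Strong convexity absorbs the growth of the inverse step sizes up to a bounded amount. -/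
theorem exists_sum_max_rpow_sub_le {c μ : ℝ} (hc0 : 0 ≤ c) (hc1 : c < 1) (hμ : 0 < μ) :
    ∃ C, 0 ≤ C ∧ ∀ T : ℕ,
      ∑ t ∈ Finset.Icc 1 T, max (((t + 1 : ℕ) : ℝ) ^ c - (t : ℝ) ^ c - μ) 0 ≤ C := by
  -- As `c < 1`, the increments of `t ^ c` tend to zero, so only finitely many exceed `μ`; the
  -- constant is the sum of those early excesses.
  have hlim : Filter.Tendsto (fun t : ℕ => c * (t : ℝ) ^ (c - 1)) Filter.atTop (nhds 0) := by
    have h := (tendsto_rpow_neg_atTop (y := 1 - c) (by linarith)).comp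
      (tendsto_natCast_atTop_atTop (R := ℝ))
    have h2 := h.const_mul c
    rw [mul_zero] at h2
    refine h2.congr fun t => ?_
    simp [neg_sub]
  obtain ⟨N, hN⟩ := Filter.eventually_atTop.1 (hlim.eventually (gt_mem_nhds hμ))
  set φ : ℕ → ℝ := fun t => max (((t + 1 : ℕ) : ℝ) ^ c - (t : ℝ) ^ c - μ) 0 with hφ
  have h0 : ∀ t, 0 ≤ φ t := fun t => le_max_right _ _
  refine ⟨∑ t ∈ Finset.range N, φ t, Finset.sum_nonneg fun t _ => h0 t, fun T => ?_⟩
  have hz : ∀ t ∈ Finset.Icc 1 T, t ∉ Finset.range N → φ t = 0 := by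
    intro t ht htN
    have ht1 : (0 : ℝ) < t := by exact_mod_cast (Finset.mem_Icc.1 ht).1
    have h1 := rpow_add_one_sub_le hc0 hc1.le ht1
    have h2 := hN t (by simpa using htN)
    apply max_eq_right
    push_cast
    linarith
  calc ∑ t ∈ Finset.Icc 1 T, φ t
      = ∑ t ∈ Finset.Icc 1 T with t ∈ Finset.range N, φ t := by
        rw [Finset.sum_filter]
        refine Finset.sum_congr rfl fun t ht => ?_
        split_ifs with hm
        · rfl
        · exact hz t ht hm
    _ ≤ _ := Finset.sum_le_sum_of_subset_of_nonneg
        (fun t ht => (Finset.mem_filter.1 ht).2) fun t _ _ => h0 t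

theorem sum_Icc_sub_succ (φ : ℕ → ℝ) (T : ℕ) :
    ∑ t ∈ Finset.Icc 1 T, (φ t - φ (t + 1)) = φ 1 - φ (T + 1) := by
  induction T with
  | zero => simp
  | succ T ih => rw [Finset.sum_Icc_succ_top (by omega), ih]; ring

end PowerSums

/-! ### Single primal and dual steps -/

section Steps

/-- One step of projected (sub)gradient descent. -/
theorem inner_metricProj_sub_le {p : ℕ} {X : Set (EuclideanSpace ℝ (Fin p))} (hX : Convex ℝ X)
    (hcl : IsClosed X) {z ω y : EuclideanSpace ℝ (Fin p)} (hy : y ∈ X) {a : ℝ} (ha : 0 < a) :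
    inner ℝ ω (metricProj X (z - (1 / a) • ω) - y)
      ≤ a / 2 * (‖z - y‖ ^ 2 - ‖metricProj X (z - (1 / a) • ω) - y‖ ^ 2
        - ‖metricProj X (z - (1 / a) • ω) - z‖ ^ 2) := by
  have h := norm_metricProj_sub_sq_le hX hcl (z - (1 / a) • ω) hy
  set x' := metricProj X (z - (1 / a) • ω)
  have e1 : z - (1 / a) • ω - y = (z - y) - (1 / a) • ω := by abel
  have e2 : z - (1 / a) • ω - x' = (z - x') - (1 / a) • ω := by abel
  rw [e1, e2, norm_sub_sq_real (z - y), norm_sub_sq_real (z - x'), norm_sub_rev z x',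
    inner_smul_right, inner_smul_right, real_inner_comm, real_inner_comm ω (z - x')] at h
  have e3 : (inner ℝ ω (x' - y) : ℝ) = inner ℝ ω (z - y) - inner ℝ ω (z - x') := by
    rw [← inner_sub_right]; congr 1; abel
  rw [e3]
  have h2 : 2 * (1 / a * (inner ℝ ω (z - y) - inner ℝ ω (z - x')))
      ≤ ‖z - y‖ ^ 2 - ‖x' - y‖ ^ 2 - ‖x' - z‖ ^ 2 := by linarith
  have h3 := mul_le_mul_of_nonneg_left h2 (show 0 ≤ a / 2 by positivity)
  refine le_trans (le_of_eq ?_) h3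
  field_simp

/-- One step of the regularized dual ascent. -/
theorem inner_sub_le_of_posPart_step {ι : Type*} [Fintype ι] {q q₀ b : EuclideanSpace ℝ ι}
    (hq₀ : ∀ k, 0 ≤ q₀ k) {a β : ℝ} (ha : 0 < a) (hβ : 0 ≤ β) :
    inner ℝ (q₀ - q) b
      ≤ 1 / 2 * ((a - β) * ‖q - q₀‖ ^ 2
          - a * ‖posPart ((1 - β * (1 / a)) • q + (1 / a) • b) - q₀‖ ^ 2)
        + β / 2 * ‖q₀‖ ^ 2 + 1 / (2 * a) * ‖b - β • q‖ ^ 2 := by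
  have h := norm_posPart_sub_le ((1 - β * (1 / a)) • q + (1 / a) • b) hq₀
  set q' := posPart ((1 - β * (1 / a)) • q + (1 / a) • b)
  have e1 : (1 - β * (1 / a)) • q + (1 / a) • b - q₀ = (q - q₀) + (1 / a) • (b - β • q) := by
    rw [sub_smul, one_smul, smul_sub, smul_smul, mul_comm β]; abel
  rw [e1] at h
  have h2 := pow_le_pow_left₀ (norm_nonneg _) h 2
  rw [norm_add_sq_real, inner_smul_right, norm_smul, inner_sub_right, inner_smul_right, mul_pow,
    Real.norm_of_nonneg (show 0 ≤ 1 / a by positivity)] at h2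
  -- Polarization of `⟪q - q₀, q⟫`: discarding `‖q‖²` leaves a contraction of rate `β` towards `q₀`,
  -- at the price `β ‖q₀‖²`.
  have h3 := norm_sub_sq_real q (q - q₀)
  rw [sub_sub_cancel, real_inner_comm] at h3
  have h4 : (inner ℝ (q₀ - q) b : ℝ) = - inner ℝ (q - q₀) b := by
    rw [← inner_neg_left, neg_sub]
  rw [h4]
  set u := ‖q - q₀‖ ^ 2
  set u' := ‖q' - q₀‖ ^ 2
  set I := (inner ℝ (q - q₀) b : ℝ)
  set S := (inner ℝ (q - q₀) q : ℝ)
  set N := ‖b - β • q‖ ^ 2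
  have h5 : a * u' ≤ a * u + 2 * (I - β * S) + 1 / a * N := by
    have := mul_le_mul_of_nonneg_left h2 ha.le
    refine this.trans (le_of_eq ?_)
    field_simp
  have h6 : 0 ≤ β * ‖q‖ ^ 2 := by positivity
  have h7 : β * ‖q₀‖ ^ 2 = β * (‖q‖ ^ 2 - 2 * S + u) := by rw [h3]
  have h8 : 1 / (2 * a) * N = 1 / 2 * (1 / a * N) := by
    field_simp
  rw [h8]
  linarith

end Steps

/-! ### Regularity bounds and the progress of one agent -/

section Run

variable {n : ℕ} {m : Fin n → ℕ} {p : ℕ} {P : Problem n m p} {R F₁ F₂ μ κ c : ℝ}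
  {W : ℕ → Matrix (Fin n) (Fin n) ℝ} {x : Fin n → ℕ → EuclideanSpace ℝ (Fin p)}
  {q : (i : Fin n) → ℕ → EuclideanSpace ℝ (Fin (m i))}

namespace Problem.Regular

theorem zero_mem (h : P.Regular R F₁ F₂) : (0 : EuclideanSpace ℝ (Fin p)) ∈ P.X := by
  obtain ⟨r, hr, hs⟩ := h.contains_ball
  exact hs (Metric.mem_closedBall_self hr.le)

theorem norm_le (h : P.Regular R F₁ F₂) {y : EuclideanSpace ℝ (Fin p)} (hy : y ∈ P.X) :
    ‖y‖ ≤ R := by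
  simpa using h.subset_ball hy

theorem radius_nonneg (h : P.Regular R F₁ F₂) : 0 ≤ R := by simpa using h.norm_le h.zero_mem

theorem norm_sub_le (h : P.Regular R F₁ F₂) {y z : EuclideanSpace ℝ (Fin p)} (hy : y ∈ P.X)
    (hz : z ∈ P.X) : ‖y - z‖ ≤ 2 * R := by
  have := _root_.norm_sub_le y z
  have := h.norm_le hy
  have := h.norm_le hz
  linarith

theorem bound_nonneg (h : P.Regular R F₁ F₂) (i : Fin n) : 0 ≤ F₁ :=
  (norm_nonneg _).trans (h.constraint_bound i 1 le_rfl 0 h.zero_mem)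

theorem subgrad_bound_nonneg (h : P.Regular R F₁ F₂) (i : Fin n) : 0 ≤ F₂ :=
  (norm_nonneg _).trans (h.loss_subgrad_bound i 1 le_rfl 0 h.zero_mem)

theorem loss_le_add (h : P.Regular R F₁ F₂) (i : Fin n) {t : ℕ} (ht : 1 ≤ t)
    {y z : EuclideanSpace ℝ (Fin p)} (hy : y ∈ P.X) (hz : z ∈ P.X) :
    P.f i t y ≤ P.f i t z + F₂ * ‖y - z‖ := by
  have h1 := h.loss_subgrad i t ht y hy z hz
  have h2 := abs_le.1 (abs_real_inner_le_norm (P.df i t y) (z - y))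
  have h3 := mul_le_mul_of_nonneg_right (h.loss_subgrad_bound i t ht y hy) (norm_nonneg (z - y))
  rw [norm_sub_rev y z]
  linarith [h2.1]

theorem constraint_le_add (h : P.Regular R F₁ F₂) (i : Fin n) {t : ℕ} (ht : 1 ≤ t)
    {y z : EuclideanSpace ℝ (Fin p)} (hy : y ∈ P.X) (hz : z ∈ P.X) (k : Fin (m i)) :
    P.g i t y k ≤ P.g i t z k + F₂ * ‖y - z‖ := by
  have h1 := h.constraint_subgrad i t ht y hy k z hz
  have h2 := abs_le.1 (abs_real_inner_le_norm
    (WithLp.toLp 2 fun a => P.dg i t y a k : EuclideanSpace ℝ (Fin p)) (z - y))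
  have h3 := mul_le_mul_of_nonneg_right ((norm_col_le (P.dg i t y) k).trans
    (h.constraint_subgrad_bound i t ht y hy)) (norm_nonneg (z - y))
  rw [norm_sub_rev y z]
  linarith [h2.1]

theorem norm_clipSubgrad_le (h : P.Regular R F₁ F₂) (i : Fin n) {t : ℕ} (ht : 1 ≤ t)
    {y : EuclideanSpace ℝ (Fin p)} (hy : y ∈ P.X) :
    ‖clipSubgrad (P.g i t y) (P.dg i t y)‖ ≤ F₂ :=
  (OnlineOpt.norm_clipSubgrad_le _ _).trans (h.constraint_subgrad_bound i t ht y hy)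

theorem norm_clipSubgrad_transpose_le (h : P.Regular R F₁ F₂) (i : Fin n) {t : ℕ} (ht : 1 ≤ t)
    {y : EuclideanSpace ℝ (Fin p)} (hy : y ∈ P.X) (u : EuclideanSpace ℝ (Fin p)) :
    ‖(clipSubgrad (P.g i t y) (P.dg i t y)).transpose.toEuclideanLin u‖ ≤ F₂ * ‖u‖ := by
  refine (norm_toEuclideanLin_le _ _).trans (mul_le_mul_of_nonneg_right ?_ (norm_nonneg _))
  rw [norm_transpose]
  exact h.norm_clipSubgrad_le i ht hy

/-- The clipped matrix consists of subgradients of the positive parts. -/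
theorem posPart_constraint_le (h : P.Regular R F₁ F₂) (i : Fin n) {t : ℕ} (ht : 1 ≤ t)
    {y z : EuclideanSpace ℝ (Fin p)} (hy : y ∈ P.X) (hz : z ∈ P.X) (k : Fin (m i)) :
    posPart (P.g i t y) k ≤ posPart (P.g i t z) k
      + (clipSubgrad (P.g i t y) (P.dg i t y)).transpose.toEuclideanLin (y - z) k := by
  rw [toEuclideanLin_transpose_apply, posPart_apply]
  have h0 := posPart_nonneg (P.g i t z) k
  by_cases hk : P.g i t y k < 0
  · have : (WithLp.toLp 2 fun a => clipSubgrad (P.g i t y) (P.dg i t y) a k :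
        EuclideanSpace ℝ (Fin p)) = 0 := by
      ext a; simp [clipSubgrad, hk]
    rw [this, inner_zero_left, max_eq_right hk.le]
    linarith
  · have : (WithLp.toLp 2 fun a => clipSubgrad (P.g i t y) (P.dg i t y) a k :
        EuclideanSpace ℝ (Fin p)) = WithLp.toLp 2 fun a => P.dg i t y a k := by
      ext a; simp [clipSubgrad, hk]
    rw [this, max_eq_left (not_lt.1 hk), ← neg_sub z y, inner_neg_right]
    have h1 : _ ≤ P.g i t z k := h.constraint_subgrad i t ht y hy k z hz
    have h2 : P.g i t z k ≤ posPart (P.g i t z) k := le_max_left _ _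
    linarith

/-- The linearization at `y` bounds all components at once, so the operator norm gives the Lipschitz
constant `F₂` without a factor depending on `m i`. -/
theorem norm_posPart_constraint_le (h : P.Regular R F₁ F₂) (i : Fin n) {t : ℕ} (ht : 1 ≤ t)
    {y z : EuclideanSpace ℝ (Fin p)} (hy : y ∈ P.X) (hz : z ∈ P.X) :
    ‖posPart (P.g i t y)‖ ≤ ‖posPart (P.g i t z)‖ + F₂ * ‖y - z‖ := by
  set J := (clipSubgrad (P.g i t y) (P.dg i t y)).transpose
  have h1 : ‖posPart (P.g i t y)‖ ≤ ‖posPart (P.g i t z) + J.toEuclideanLin (y - z)‖ :=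
    norm_le_norm_of_abs_le fun k => by
      rw [abs_of_nonneg (posPart_nonneg _ _)]
      exact (h.posPart_constraint_le i ht hy hz k).trans (le_abs_self _)
  have h2 := norm_add_le (posPart (P.g i t z)) (J.toEuclideanLin (y - z))
  have h3 := h.norm_clipSubgrad_transpose_le i ht hy (y - z)
  linarith

end Problem.Regular

namespace Problem.IsRun

variable {α β γ : ℕ → ℝ}

theorem mem (hP : P.Regular R F₁ F₂) (h : P.IsRun W α β γ x q) (i : Fin n) {t : ℕ}
    (ht : 1 ≤ t) : x i t ∈ P.X := by
  rcases Nat.lt_or_ge 1 t with h1 | h1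
  · obtain ⟨s, rfl⟩ : ∃ s, t = s + 1 := ⟨t - 1, by omega⟩
    rw [h.step_primal i s (by omega)]
    exact (metricProj_spec ⟨0, hP.zero_mem⟩ hP.closed _).1
  · obtain rfl : t = 1 := by omega
    exact h.init_primal i

theorem dual_nonneg (h : P.IsRun W α β γ x q) (i : Fin n) {t : ℕ} (ht : 1 ≤ t)
    (k : Fin (m i)) : 0 ≤ q i t k := by
  rcases Nat.lt_or_ge 1 t with h1 | h1
  · obtain ⟨s, rfl⟩ : ∃ s, t = s + 1 := ⟨t - 1, by omega⟩
    rw [h.step_dual i s (by omega)]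
    exact posPart_nonneg _ _
  · obtain rfl : t = 1 := by omega
    simp [h.init_dual i]

theorem norm_linearized_constraint_le (hP : P.Regular R F₁ F₂) (h : P.IsRun W α β γ x q)
    (i : Fin n) {t : ℕ} (ht : 1 ≤ t) :
    ‖posPart (P.g i t (x i t)) + (clipSubgrad (P.g i t (x i t))
      (P.dg i t (x i t))).transpose.toEuclideanLin (x i (t + 1) - x i t)‖
      ≤ F₁ + 2 * F₂ * R := by
  have hm := h.mem hP i ht
  have h1 := (norm_posPart_le _).trans (hP.constraint_bound i t ht _ hm)
  have h2 := hP.norm_clipSubgrad_transpose_le i ht hm (x i (t + 1) - x i t)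
  have h3 := mul_le_mul_of_nonneg_left
    (hP.norm_sub_le (h.mem hP i (Nat.le_add_left 1 t)) hm) (hP.subgrad_bound_nonneg i)
  refine (norm_add_le _ _).trans ?_
  linarith

/-- The regularization keeps the dual variables of order `t ^ κ`. -/
theorem norm_dual_le (hκ0 : 0 < κ) (hP : P.Regular R F₁ F₂)
    (h : P.IsRun W α (fun t => 1 / (t : ℝ) ^ κ) (fun t => 1 / (t : ℝ) ^ (1 - κ)) x q)
    (i : Fin n) {t : ℕ} (ht : 1 ≤ t) : ‖q i t‖ ≤ (F₁ + 2 * F₂ * R) * (t : ℝ) ^ κ := by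
  have hB : 0 ≤ F₁ + 2 * F₂ * R :=
    (norm_nonneg _).trans (h.norm_linearized_constraint_le hP i le_rfl)
  induction t, ht using Nat.le_induction with
  | base => simpa [h.init_dual i] using hB
  | succ t ht ih =>
    rw [h.step_dual i t ht]
    have hb := h.norm_linearized_constraint_le hP i ht
    set b := posPart (P.g i t (x i t)) + (clipSubgrad (P.g i t (x i t))
      (P.dg i t (x i t))).transpose.toEuclideanLin (x i (t + 1) - x i t)
    refine (norm_posPart_le _).trans ?_
    have hs : (0 : ℝ) < ((t + 1 : ℕ) : ℝ) := by positivity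
    have hmul : ((t + 1 : ℕ) : ℝ) ^ κ * ((t + 1 : ℕ) : ℝ) ^ (1 - κ) = ((t + 1 : ℕ) : ℝ) := by
      rw [← Real.rpow_add hs]; simp
    have hts : (t : ℝ) ^ κ ≤ ((t + 1 : ℕ) : ℝ) ^ κ :=
      Real.rpow_le_rpow (by positivity) (by push_cast; linarith) hκ0.le
    have hsκ : 0 < ((t + 1 : ℕ) : ℝ) ^ κ := Real.rpow_pos_of_pos hs _
    have hsκ' : 0 < ((t + 1 : ℕ) : ℝ) ^ (1 - κ) := Real.rpow_pos_of_pos hs _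
    have hs1 : (1 : ℝ) ≤ ((t + 1 : ℕ) : ℝ) := by push_cast; linarith [(t.cast_nonneg : (0 : ℝ) ≤ t)]
    set s := ((t + 1 : ℕ) : ℝ)
    -- Hence the update before clipping is a convex combination, with weights `1 - 1 / s` and `1 /
    -- s`, of `q` and `s ^ κ • b`; both obey the claimed bound.
    have hβγ : 1 / s ^ κ * (1 / s ^ (1 - κ)) = 1 / s := by
      rw [div_mul_div_comm, one_mul, hmul]
    have h1 : 0 ≤ 1 - 1 / s := by
      rw [sub_nonneg, div_le_one hs]; exact hs1
    simp only [hβγ]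
    refine (norm_add_le _ _).trans ?_
    rw [norm_smul, norm_smul, Real.norm_of_nonneg h1, Real.norm_of_nonneg (by positivity)]
    have h2 := mul_le_mul_of_nonneg_left (ih.trans (mul_le_mul_of_nonneg_left hts hB)) h1
    have h3 := mul_le_mul_of_nonneg_left hb (show 0 ≤ 1 / s ^ (1 - κ) by positivity)
    have h4 : 1 / s ^ (1 - κ) = s ^ κ / s := by
      rw [div_eq_div_iff hsκ'.ne' hs.ne', one_mul, hmul]
    rw [h4] at h3 ⊢
    have h5 : (1 - 1 / s) * ((F₁ + 2 * F₂ * R) * s ^ κ) + s ^ κ / s * (F₁ + 2 * F₂ * R)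
        = (F₁ + 2 * F₂ * R) * s ^ κ := by
      field_simp
      ring
    linarith

/-- The combined primal-dual progress of agent `i` in round `t`. -/
theorem agent_step (hκ0 : 0 < κ) (hP : P.Regular R F₁ F₂) (hS : P.StronglyConvex μ)
    (h : P.IsRun W (fun t => 1 / (t : ℝ) ^ c) (fun t => 1 / (t : ℝ) ^ κ)
      (fun t => 1 / (t : ℝ) ^ (1 - κ)) x q)
    (i : Fin n) {t : ℕ} (ht : 1 ≤ t) {y : EuclideanSpace ℝ (Fin p)} (hy : y ∈ P.X)
    (hgy : ∀ k, P.g i t y k ≤ 0) {q₀ : EuclideanSpace ℝ (Fin (m i))} (hq₀ : ∀ k, 0 ≤ q₀ k)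
    {K : ℝ} (hK : ‖q₀‖ ≤ K) :
    P.f i t (x i t) - P.f i t y + inner ℝ q₀ (posPart (P.g i t (x i t)))
        + ((t + 1 : ℕ) : ℝ) ^ c / 2 * ‖x i (t + 1) - ∑ j, W t i j • x j t‖ ^ 2
      ≤ F₂ * (1 + K) * ‖x i (t + 1) - x i t‖
        + ((t + 1 : ℕ) : ℝ) ^ c / 2
          * (‖∑ j, W t i j • x j t - y‖ ^ 2 - ‖x i (t + 1) - y‖ ^ 2)
        - μ / 2 * ‖x i t - y‖ ^ 2
        + 1 / 2 * ((t : ℝ) ^ (1 - κ) * ‖q i t - q₀‖ ^ 2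
          - ((t + 1 : ℕ) : ℝ) ^ (1 - κ) * ‖q i (t + 1) - q₀‖ ^ 2)
        + K ^ 2 / 2 * (1 / ((t + 1 : ℕ) : ℝ) ^ κ)
        + 2 * (F₁ + 2 * F₂ * R) ^ 2 * (1 / ((t + 1 : ℕ) : ℝ) ^ (1 - κ)) := by
  have hxm := h.mem hP i ht
  have hb := h.norm_linearized_constraint_le hP i ht
  have hqb := h.norm_dual_le hκ0 hP i ht
  have hq0 := h.dual_nonneg i ht
  have hprimal := h.step_primal i t ht
  have hdual := h.step_dual i t ht
  have hJ := hP.norm_clipSubgrad_transpose_le i ht hxm (x i (t + 1) - x i t)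
  have hcvx := hP.posPart_constraint_le i ht hxm hy
  have ht0 : (0 : ℝ) < t := by exact_mod_cast ht
  have hs : (0 : ℝ) < ((t + 1 : ℕ) : ℝ) := by positivity
  have hst : (t : ℝ) = ((t + 1 : ℕ) : ℝ) - 1 := by push_cast; ring
  have hts : (t : ℝ) ^ κ ≤ ((t + 1 : ℕ) : ℝ) ^ κ :=
    Real.rpow_le_rpow ht0.le (by push_cast; linarith) hκ0.le
  have hF₂ := hP.subgrad_bound_nonneg i
  have hdf := hP.loss_subgrad_bound i t ht _ hxm
  have hsc := hS i t ht y hy _ hxm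
  simp only at hprimal hdual
  set J := clipSubgrad (P.g i t (x i t)) (P.dg i t (x i t))
  set g₀ := posPart (P.g i t (x i t))
  set z := ∑ j, W t i j • x j t
  set x' := x i (t + 1)
  set q' := q i (t + 1)
  set s := ((t + 1 : ℕ) : ℝ)
  set B₁ := F₁ + 2 * F₂ * R
  set b := g₀ + J.transpose.toEuclideanLin (x' - x i t) with hbdef
  have hsκ : 0 < s ^ κ := Real.rpow_pos_of_pos hs _
  have hsκ' : 0 < s ^ (1 - κ) := Real.rpow_pos_of_pos hs _
  have hsc' : 0 < s ^ c := Real.rpow_pos_of_pos hs _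
  have htκ : 0 < (t : ℝ) ^ κ := Real.rpow_pos_of_pos ht0 _
  have hB : 0 ≤ B₁ := (norm_nonneg _).trans hb
  have h1 := inner_metricProj_sub_le hP.convex hP.closed (z := z)
    (ω := P.df i t (x i t) + J.toEuclideanLin (q i t)) hy hsc'
  rw [← hprimal, inner_add_left, inner_toEuclideanLin] at h1
  have h2 : (inner ℝ (P.df i t (x i t)) (x' - y) : ℝ)
      = inner ℝ (P.df i t (x i t)) (x' - x i t) - inner ℝ (y - x i t) (P.df i t (x i t)) := by
    rw [real_inner_comm _ (y - x i t), ← inner_sub_right]; congr 1; abel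
  have h3 := (abs_le.1 (abs_real_inner_le_norm (P.df i t (x i t)) (x' - x i t))).1
  have h3' := mul_le_mul_of_nonneg_right hdf (norm_nonneg (x' - x i t))
  -- Feasibility of `y` makes `[g]_+` vanish there, so convexity of the positive part and `q ≥ 0`
  -- give the coupling with the dual step.
  have h4 : (inner ℝ (q i t) b : ℝ) ≤ inner ℝ (q i t) (J.transpose.toEuclideanLin (x' - y)) := by
    refine inner_le_inner_of_le hq0 fun k => ?_
    have e : x' - y = (x' - x i t) + (x i t - y) := by abel
    have hz : posPart (P.g i t y) k = 0 := max_eq_right (hgy k)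
    rw [e, map_add, hbdef, PiLp.add_apply, PiLp.add_apply]
    have := hcvx k
    linarith
  have h5 := inner_sub_le_of_posPart_step (q := q i t) (b := b) hq₀ hsκ'
    (show 0 ≤ 1 / s ^ κ by positivity)
  rw [← hdual, inner_sub_left] at h5
  have h6 : (inner ℝ q₀ b : ℝ)
      = inner ℝ q₀ g₀ + inner ℝ q₀ (J.transpose.toEuclideanLin (x' - x i t)) := inner_add_right ..
  have h7 := (abs_le.1 (abs_real_inner_le_norm q₀ (J.transpose.toEuclideanLin (x' - x i t)))).1
  have h7' : ‖q₀‖ * ‖J.transpose.toEuclideanLin (x' - x i t)‖ ≤ K * (F₂ * ‖x' - x i t‖) :=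
    mul_le_mul hK hJ (norm_nonneg _) ((norm_nonneg _).trans hK)
  -- The coefficient on the left is `t / s ^ κ`, and `t ≤ s`: the regularization offsets the growth
  -- of `1 / γ`, so the dual terms telescope.
  have h8 : (s ^ (1 - κ) - 1 / s ^ κ) * ‖q i t - q₀‖ ^ 2
      ≤ (t : ℝ) ^ (1 - κ) * ‖q i t - q₀‖ ^ 2 := by
    refine mul_le_mul_of_nonneg_right ?_ (sq_nonneg _)
    rw [Real.rpow_sub hs, Real.rpow_sub ht0, Real.rpow_one, Real.rpow_one, ← sub_div, ← hst]
    exact div_le_div_of_nonneg_left ht0.le htκ hts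
  -- `β = 1 / s ^ κ` exactly offsets the growth of the dual variable.
  have h9 : ‖b - (1 / s ^ κ) • q i t‖ ≤ 2 * B₁ := by
    refine (norm_sub_le _ _).trans ?_
    rw [norm_smul, Real.norm_of_nonneg (by positivity)]
    have h91 := mul_le_mul_of_nonneg_left
      (hqb.trans (mul_le_mul_of_nonneg_left hts hB)) (show 0 ≤ 1 / s ^ κ by positivity)
    have h92 : 1 / s ^ κ * (B₁ * s ^ κ) = B₁ := by field_simp
    linarith
  have h10 : 1 / (2 * s ^ (1 - κ)) * ‖b - (1 / s ^ κ) • q i t‖ ^ 2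
      ≤ 2 * B₁ ^ 2 * (1 / s ^ (1 - κ)) := by
    have := mul_le_mul_of_nonneg_left (pow_le_pow_left₀ (norm_nonneg _) h9 2)
      (show 0 ≤ 1 / (2 * s ^ (1 - κ)) by positivity)
    refine this.trans (le_of_eq ?_)
    field_simp
  have h11 : 1 / s ^ κ / 2 * ‖q₀‖ ^ 2 ≤ K ^ 2 / 2 * (1 / s ^ κ) := by
    have := mul_le_mul_of_nonneg_left (pow_le_pow_left₀ (norm_nonneg _) hK 2)
      (show 0 ≤ 1 / s ^ κ / 2 by positivity)
    linarith
  rw [norm_sub_rev y] at hsc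
  linarith

end Problem.IsRun

end Run

/-! ### Summation over agents and rounds -/

section Regret

variable {n : ℕ} {m : Fin n → ℕ} {p : ℕ} {P : Problem n m p} {R F₁ F₂ μ κ c w : ℝ} {B : ℕ}
  {G : ℕ → Digraph (Fin n)} {W : ℕ → Matrix (Fin n) (Fin n) ℝ}
  {x : Fin n → ℕ → EuclideanSpace ℝ (Fin p)}
  {q : (i : Fin n) → ℕ → EuclideanSpace ℝ (Fin (m i))}

/-- Mixing does not increase the total squared distance to a fixed point. -/
theorem MixingNetwork.sum_norm_sub_sq_le (h : MixingNetwork G W w B) {t : ℕ} (ht : 1 ≤ t)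
    (v : Fin n → EuclideanSpace ℝ (Fin p)) (y : EuclideanSpace ℝ (Fin p)) :
    ∑ i, ‖∑ j, W t i j • v j - y‖ ^ 2 ≤ ∑ i, ‖v i - y‖ ^ 2 := by
  -- Jensen's inequality uses the row sums; the column sums then restore the unweighted total.
  have hcvx : ConvexOn ℝ Set.univ fun u : EuclideanSpace ℝ (Fin p) => ‖u‖ ^ 2 :=
    convexOn_univ_norm.pow (fun _ _ => norm_nonneg _) 2
  have h1 : ∀ i, ‖∑ j, W t i j • v j - y‖ ^ 2 ≤ ∑ j, W t i j * ‖v j - y‖ ^ 2 := by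
    intro i
    have e : ∑ j, W t i j • v j - y = ∑ j, W t i j • (v j - y) := by
      simp only [smul_sub, Finset.sum_sub_distrib]
      rw [← Finset.sum_smul, h.row_sum t ht i, one_smul]
    rw [e]
    exact hcvx.map_sum_le (fun j _ => h.nonneg ht i j) (h.row_sum t ht i)
      fun j _ => Set.mem_univ _
  refine (Finset.sum_le_sum fun i _ => h1 i).trans (le_of_eq ?_)
  rw [Finset.sum_comm]
  refine Finset.sum_congr rfl fun j _ => ?_
  rw [← Finset.sum_mul, h.col_sum t ht j, one_mul]

/-- Summation by parts: `t ^ c * d t` telescopes, and the remainder carries the factor `(t+1) ^ c -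
t ^ c - μ`, whose positive parts have bounded sum. Here `d` is a squared distance to the comparator.
-/
theorem sum_rpow_mul_sub_le {c μ C D : ℝ} {T : ℕ} {d : ℕ → ℝ}
    (hd0 : ∀ t ≥ 1, 0 ≤ d t) (hd : ∀ t ≥ 1, d t ≤ D)
    (hC : ∑ t ∈ Finset.Icc 1 T, max (((t + 1 : ℕ) : ℝ) ^ c - (t : ℝ) ^ c - μ) 0 ≤ C) :
    ∑ t ∈ Finset.Icc 1 T, (((t + 1 : ℕ) : ℝ) ^ c / 2 * (d t - d (t + 1)) - μ / 2 * d t)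
      ≤ D / 2 * (1 + C) := by
  have hD : 0 ≤ D := (hd0 1 le_rfl).trans (hd 1 le_rfl)
  have h1 : ∀ t ∈ Finset.Icc 1 T,
      ((t + 1 : ℕ) : ℝ) ^ c / 2 * (d t - d (t + 1)) - μ / 2 * d t
        ≤ 1 / 2 * ((t : ℝ) ^ c * d t - ((t + 1 : ℕ) : ℝ) ^ c * d (t + 1))
          + D / 2 * max (((t + 1 : ℕ) : ℝ) ^ c - (t : ℝ) ^ c - μ) 0 := by
    intro t ht
    have ht1 := (Finset.mem_Icc.1 ht).1
    have h2 := mul_le_mul_of_nonneg_right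
      (le_max_left (((t + 1 : ℕ) : ℝ) ^ c - (t : ℝ) ^ c - μ) 0) (hd0 t ht1)
    have h3 := mul_le_mul_of_nonneg_left (hd t ht1)
      (le_max_right (((t + 1 : ℕ) : ℝ) ^ c - (t : ℝ) ^ c - μ) 0)
    linarith
  refine (Finset.sum_le_sum h1).trans ?_
  rw [Finset.sum_add_distrib, ← Finset.mul_sum, ← Finset.mul_sum,
    sum_Icc_sub_succ fun t : ℕ => (t : ℝ) ^ c * d t]
  have h4 : 0 ≤ ((T + 1 : ℕ) : ℝ) ^ c * d (T + 1) :=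
    mul_nonneg (by positivity) (hd0 _ (by omega))
  have h5 := mul_le_mul_of_nonneg_left hC (show 0 ≤ D / 2 by positivity)
  have h6 := hd 1 le_rfl
  simp only [Nat.cast_one, Real.one_rpow, one_mul]
  linarith

namespace Problem.IsRun

/-- The loss of the network in round `t` against the losses of the agents at their own points. -/
theorem sum_globalLoss_sub_le {α β γ : ℕ → ℝ} (hn : 0 < n) (hP : P.Regular R F₁ F₂)
    (h : P.IsRun W α β γ x q) {t : ℕ} (ht : 1 ≤ t) (y : EuclideanSpace ℝ (Fin p)) :
    ∑ i, (P.globalLoss t (x i t) - P.globalLoss t y)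
      ≤ ∑ i, (P.f i t (x i t) - P.f i t y) + n * F₂ * spread fun i => x i t := by
  have hn' : (0 : ℝ) < n := by exact_mod_cast hn
  have h1 : ∀ i, P.globalLoss t (x i t)
      ≤ 1 / n * ∑ j, P.f j t (x j t) + F₂ * spread fun i => x i t := by
    intro i
    have h2 : ∑ j, P.f j t (x i t)
        ≤ ∑ j, P.f j t (x j t) + n * (F₂ * spread fun i => x i t) := by
      calc ∑ j, P.f j t (x i t)
          ≤ ∑ j, (P.f j t (x j t) + F₂ * spread fun i => x i t) := by
            refine Finset.sum_le_sum fun j _ => ?_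
            have h3 := hP.loss_le_add j ht (h.mem hP i ht) (h.mem hP j ht)
            have h4 := mul_le_mul_of_nonneg_left (norm_sub_le_spread (fun i => x i t) i j)
              (hP.subgrad_bound_nonneg j)
            linarith
        _ = _ := by rw [Finset.sum_add_distrib]; simp
    unfold Problem.globalLoss
    have h5 := mul_le_mul_of_nonneg_left h2 (show 0 ≤ 1 / (n : ℝ) by positivity)
    refine h5.trans (le_of_eq ?_)
    field_simp
  have h6 := Finset.sum_le_sum fun i (_ : i ∈ Finset.univ) => h1 i
  rw [Finset.sum_sub_distrib, Finset.sum_sub_distrib]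
  have h7 : ∑ _i : Fin n, P.globalLoss t y = ∑ i, P.f i t y := by
    simp only [Finset.sum_const, Finset.card_univ, Fintype.card_fin, nsmul_eq_mul,
      Problem.globalLoss]
    field_simp
  have h8 : ∑ _i : Fin n, (1 / n * ∑ j, P.f j t (x j t) + F₂ * spread fun i => x i t)
      = ∑ j, P.f j t (x j t) + n * F₂ * spread fun i => x i t := by
    simp only [Finset.sum_const, Finset.card_univ, Fintype.card_fin, nsmul_eq_mul]
    field_simp
  rw [h7]
  linarith

/-- The combined progress of all agents in round `t`. -/
theorem network_step (hn : 0 < n) (hκ0 : 0 < κ) (hP : P.Regular R F₁ F₂)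
    (hS : P.StronglyConvex μ) (hW : MixingNetwork G W w B)
    (h : P.IsRun W (fun t => 1 / (t : ℝ) ^ c) (fun t => 1 / (t : ℝ) ^ κ)
      (fun t => 1 / (t : ℝ) ^ (1 - κ)) x q)
    {t : ℕ} (ht : 1 ≤ t) {y : EuclideanSpace ℝ (Fin p)} (hy : y ∈ P.X)
    (hgy : ∀ i k, P.g i t y k ≤ 0) {q₀ : (i : Fin n) → EuclideanSpace ℝ (Fin (m i))}
    (hq₀ : ∀ i k, 0 ≤ q₀ i k) {K : ℝ} (hK : ∀ i, ‖q₀ i‖ ≤ K) :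
    ∑ i, (P.globalLoss t (x i t) - P.globalLoss t y)
        + ∑ i, inner ℝ (q₀ i) (posPart (P.g i t (x i t))) + K * (spread fun i => x i t)
      ≤ (1 + K) * (F₂ * ∑ i, ‖x i (t + 1) - ∑ j, W t i j • x j t‖
          + (2 * n * F₂ + 1) * spread fun i => x i t)
        - ∑ i, ((t + 1 : ℕ) : ℝ) ^ c / 2 * ‖x i (t + 1) - ∑ j, W t i j • x j t‖ ^ 2
        + ∑ i, (((t + 1 : ℕ) : ℝ) ^ c / 2 * (‖x i t - y‖ ^ 2 - ‖x i (t + 1) - y‖ ^ 2)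
          - μ / 2 * ‖x i t - y‖ ^ 2)
        + ∑ i, 1 / 2 * ((t : ℝ) ^ (1 - κ) * ‖q i t - q₀ i‖ ^ 2
          - ((t + 1 : ℕ) : ℝ) ^ (1 - κ) * ‖q i (t + 1) - q₀ i‖ ^ 2)
        + n * K ^ 2 / 2 * (1 / ((t + 1 : ℕ) : ℝ) ^ κ)
        + 2 * n * (F₁ + 2 * F₂ * R) ^ 2 * (1 / ((t + 1 : ℕ) : ℝ) ^ (1 - κ)) := by
  have hF₂ := hP.subgrad_bound_nonneg ⟨0, hn⟩
  have hK0 : 0 ≤ K := (norm_nonneg _).trans (hK ⟨0, hn⟩)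
  have h1 := h.sum_globalLoss_sub_le hn hP ht y
  have h2 := Finset.sum_le_sum fun i (_ : i ∈ Finset.univ) =>
    h.agent_step hκ0 hP hS i ht hy (hgy i) (hq₀ i) (hK i)
  have h3 : ∀ i, ‖x i (t + 1) - x i t‖
      ≤ ‖x i (t + 1) - ∑ j, W t i j • x j t‖ + spread fun i => x i t := by
    intro i
    have e : x i (t + 1) - x i t
        = (x i (t + 1) - ∑ j, W t i j • x j t) + ∑ j, W t i j • (x j t - x i t) := by
      simp only [smul_sub, Finset.sum_sub_distrib]
      rw [← Finset.sum_smul, hW.row_sum t ht i, one_smul]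
      abel
    rw [e]
    refine (norm_add_le _ _).trans (add_le_add le_rfl ?_)
    exact norm_sum_smul_le (hW.nonneg ht i) (hW.row_sum t ht i)
      fun j => norm_sub_le_spread (fun i => x i t) j i
  have h4 : ∑ i, F₂ * (1 + K) * ‖x i (t + 1) - x i t‖
      ≤ F₂ * (1 + K) * (∑ i, ‖x i (t + 1) - ∑ j, W t i j • x j t‖
        + n * spread fun i => x i t) := by
    rw [← Finset.mul_sum]
    refine mul_le_mul_of_nonneg_left ?_ (by positivity)
    refine (Finset.sum_le_sum fun i _ => h3 i).trans (le_of_eq ?_)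
    rw [Finset.sum_add_distrib]; simp
  have h5 := mul_le_mul_of_nonneg_left (hW.sum_norm_sub_sq_le ht (fun i => x i t) y)
    (show 0 ≤ ((t + 1 : ℕ) : ℝ) ^ c / 2 by positivity)
  have hs0 : 0 ≤ spread fun i => x i t := spread_nonneg _
  have h6 : 0 ≤ K * (n * F₂ * spread fun i => x i t) := by positivity
  simp only [Finset.sum_add_distrib, Finset.sum_sub_distrib, ← Finset.mul_sum, mul_sub,
    Finset.sum_const, Finset.card_univ, Fintype.card_fin, nsmul_eq_mul] at h1 h2 h4 h5 ⊢
  linarith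

/-- The regret, the weighted constraint violation and the weighted disagreement are bounded
together. -/
theorem regret_add_violation_le (hn : 0 < n) (hw : 0 < w) (hκ0 : 0 < κ)
    (hP : P.Regular R F₁ F₂) (hS : P.StronglyConvex μ) (hW : MixingNetwork G W w B)
    (h : P.IsRun W (fun t => 1 / (t : ℝ) ^ c) (fun t => 1 / (t : ℝ) ^ κ)
      (fun t => 1 / (t : ℝ) ^ (1 - κ)) x q)
    {T : ℕ} {C₀ : ℝ}
    (hC₀ : ∑ t ∈ Finset.Icc 1 T, max (((t + 1 : ℕ) : ℝ) ^ c - (t : ℝ) ^ c - μ) 0 ≤ C₀)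
    {y : EuclideanSpace ℝ (Fin p)} (hy : y ∈ P.staticFeasible T)
    {q₀ : (i : Fin n) → EuclideanSpace ℝ (Fin (m i))}
    (hq₀ : ∀ i k, 0 ≤ q₀ i k) {K : ℝ} (hK : ∀ i, ‖q₀ i‖ ≤ K)
    {H : ℝ} (hH : H = (2 * n * F₂ + 1) * (n * B / w ^ (n * B))) :
    ∑ t ∈ Finset.Icc 1 T, ∑ i, (P.globalLoss t (x i t) - P.globalLoss t y)
        + ∑ t ∈ Finset.Icc 1 T, ∑ i, inner ℝ (q₀ i) (posPart (P.g i t (x i t)))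
        + K * ∑ t ∈ Finset.Icc 1 T, (spread fun i => x i t)
      ≤ (1 + K) * (2 * R * H)
        + n * ((1 + K) * (F₂ + 2 * H)) ^ 2 / 2
          * ∑ t ∈ Finset.Icc 1 T, 1 / ((t + 1 : ℕ) : ℝ) ^ c
        + n * (2 * R ^ 2 * (1 + C₀)) + n * K ^ 2 / 2
        + n * K ^ 2 / 2 * ∑ t ∈ Finset.Icc 1 T, 1 / ((t + 1 : ℕ) : ℝ) ^ κ
        + 2 * n * (F₁ + 2 * F₂ * R) ^ 2
          * ∑ t ∈ Finset.Icc 1 T, 1 / ((t + 1 : ℕ) : ℝ) ^ (1 - κ) := by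
  have hF₂ := hP.subgrad_bound_nonneg ⟨0, hn⟩
  have hR := hP.radius_nonneg
  have hK0 : 0 ≤ K := (norm_nonneg _).trans (hK ⟨0, hn⟩)
  set e : Fin n → ℕ → ℝ := fun i t => ‖x i (t + 1) - ∑ j, W t i j • x j t‖ with he
  set D : ℕ → ℝ := fun t => spread fun i => x i t with hD
  have hH0 : 0 ≤ H := by rw [hH]; positivity
  have hstep := Finset.sum_le_sum fun t (ht : t ∈ Finset.Icc 1 T) =>
    h.network_step hn hκ0 hP hS hW (Finset.mem_Icc.1 ht).1 hy.1
      (fun i k => hy.2 t ht ⟨i, k⟩) hq₀ hK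
  have hcons : (2 * n * F₂ + 1) * ∑ t ∈ Finset.Icc 1 T, D t
      ≤ H * (2 * R + 2 * ∑ t ∈ Finset.Icc 1 T, ∑ i, e i t) := by
    -- The perturbation bound must hold for all agents at once, so the sum over agents is used.
    have h1 := hW.sum_spread_le hn hw (x := x) (e := fun t => ∑ i, e i t)
      (fun t _ => Finset.sum_nonneg fun i _ => norm_nonneg _)
      (fun t _ i => Finset.single_le_sum (f := fun i => e i t) (fun i _ => norm_nonneg _)
        (Finset.mem_univ i))
      (by positivity : 0 ≤ 2 * R)
      (fun t ht i j => hP.norm_sub_le (h.mem hP i ht) (h.mem hP j ht)) T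
    have hwp : 0 < w ^ (n * B) := by positivity
    have h2 : ∑ t ∈ Finset.Icc 1 T, D t
        ≤ n * B / w ^ (n * B) * (2 * R + 2 * ∑ t ∈ Finset.Icc 1 T, ∑ i, e i t) := by
      rw [div_mul_eq_mul_div, le_div_iff₀ hwp, mul_comm]
      exact h1
    rw [hH, mul_assoc (2 * n * F₂ + 1)]
    exact mul_le_mul_of_nonneg_left h2 (by positivity)
  -- Young's inequality: `F₂` comes from the one-step estimate and `2 * H` from consensus; the
  -- quadratic part is cancelled by the proximal term.
  have habs : (1 + K) * (F₂ + 2 * H) * ∑ t ∈ Finset.Icc 1 T, ∑ i, e i t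
      ≤ ∑ t ∈ Finset.Icc 1 T, ∑ i, ((t + 1 : ℕ) : ℝ) ^ c / 2 * e i t ^ 2
        + n * ((1 + K) * (F₂ + 2 * H)) ^ 2 / 2
          * ∑ t ∈ Finset.Icc 1 T, 1 / ((t + 1 : ℕ) : ℝ) ^ c := by
    rw [Finset.mul_sum, Finset.mul_sum, ← Finset.sum_add_distrib]
    refine Finset.sum_le_sum fun t _ => ?_
    have hterm : ∀ i, (1 + K) * (F₂ + 2 * H) * e i t
        ≤ ((t + 1 : ℕ) : ℝ) ^ c / 2 * e i t ^ 2
          + ((1 + K) * (F₂ + 2 * H)) ^ 2 / 2 * (1 / ((t + 1 : ℕ) : ℝ) ^ c) := by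
      intro i
      have ha : 0 < ((t + 1 : ℕ) : ℝ) ^ c := Real.rpow_pos_of_pos (by positivity) _
      set a := ((t + 1 : ℕ) : ℝ) ^ c
      set b := (1 + K) * (F₂ + 2 * H)
      have h3 : 0 ≤ 1 / (2 * a) * (a * e i t - b) ^ 2 := by positivity
      have h4 : 1 / (2 * a) * (a * e i t - b) ^ 2
          = a / 2 * e i t ^ 2 + b ^ 2 / 2 * (1 / a) - b * e i t := by
        field_simp
        ring
      linarith
    rw [Finset.mul_sum]
    refine (Finset.sum_le_sum fun i _ => hterm i).trans (le_of_eq ?_)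
    rw [Finset.sum_add_distrib]
    simp only [Finset.sum_const, Finset.card_univ, Fintype.card_fin, nsmul_eq_mul]
    ring
  have hprim : ∑ t ∈ Finset.Icc 1 T, ∑ i,
      (((t + 1 : ℕ) : ℝ) ^ c / 2 * (‖x i t - y‖ ^ 2 - ‖x i (t + 1) - y‖ ^ 2)
        - μ / 2 * ‖x i t - y‖ ^ 2) ≤ n * (2 * R ^ 2 * (1 + C₀)) := by
    rw [Finset.sum_comm]
    refine (Finset.sum_le_sum fun i _ => sum_rpow_mul_sub_le (d := fun t => ‖x i t - y‖ ^ 2)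
      (D := (2 * R) ^ 2) (fun t _ => by positivity)
      (fun t ht => pow_le_pow_left₀ (norm_nonneg _)
        (hP.norm_sub_le (h.mem hP i ht) hy.1) 2) hC₀).trans (le_of_eq ?_)
    simp only [Finset.sum_const, Finset.card_univ, Fintype.card_fin, nsmul_eq_mul]
    ring
  have hdual : ∑ t ∈ Finset.Icc 1 T, ∑ i, 1 / 2 * ((t : ℝ) ^ (1 - κ) * ‖q i t - q₀ i‖ ^ 2
      - ((t + 1 : ℕ) : ℝ) ^ (1 - κ) * ‖q i (t + 1) - q₀ i‖ ^ 2) ≤ n * K ^ 2 / 2 := by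
    rw [Finset.sum_comm]
    have hterm : ∀ i, ∑ t ∈ Finset.Icc 1 T, 1 / 2 * ((t : ℝ) ^ (1 - κ) * ‖q i t - q₀ i‖ ^ 2
        - ((t + 1 : ℕ) : ℝ) ^ (1 - κ) * ‖q i (t + 1) - q₀ i‖ ^ 2) ≤ K ^ 2 / 2 := by
      intro i
      rw [← Finset.mul_sum,
        sum_Icc_sub_succ fun t : ℕ => (t : ℝ) ^ (1 - κ) * ‖q i t - q₀ i‖ ^ 2]
      have h1 : 0 ≤ ((T + 1 : ℕ) : ℝ) ^ (1 - κ) * ‖q i (T + 1) - q₀ i‖ ^ 2 := by positivity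
      have h2 := pow_le_pow_left₀ (norm_nonneg _) (hK i) 2
      simp only [Nat.cast_one, Real.one_rpow, one_mul, h.init_dual i, zero_sub, norm_neg]
      linarith
    refine (Finset.sum_le_sum fun i _ => hterm i).trans (le_of_eq ?_)
    simp only [Finset.sum_const, Finset.card_univ, Fintype.card_fin, nsmul_eq_mul]
    ring
  have hcons' := mul_le_mul_of_nonneg_left hcons (show 0 ≤ 1 + K by linarith)
  rw [Finset.sum_add_distrib, Finset.sum_add_distrib, Finset.sum_add_distrib,
    Finset.sum_add_distrib, Finset.sum_add_distrib, Finset.sum_add_distrib,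
    Finset.sum_sub_distrib, ← Finset.mul_sum, ← Finset.mul_sum, ← Finset.mul_sum,
    ← Finset.mul_sum, Finset.sum_add_distrib, ← Finset.mul_sum, ← Finset.mul_sum] at hstep
  linarith

end Problem.IsRun

end Regret

/-! ### Rates, existence of minimizers and violation estimates -/

section Bounds

variable {n : ℕ} {m : Fin n → ℕ} {p : ℕ} {P : Problem n m p} {R F₁ F₂ μ κ c w : ℝ} {B : ℕ}
  {G : ℕ → Digraph (Fin n)} {W : ℕ → Matrix (Fin n) (Fin n) ℝ}
  {x : Fin n → ℕ → EuclideanSpace ℝ (Fin p)}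
  {q : (i : Fin n) → ℕ → EuclideanSpace ℝ (Fin (m i))}

/-- The constant in the joint bound on regret and constraint violation. -/
noncomputable def boundConst (n : ℕ) (R F₁ F₂ κ c C₀ H : ℝ) : ℝ :=
  2 * (2 * R * H) + n * (F₂ + 2 * H) ^ 2 * (2 / (1 - c)) + n * (2 * R ^ 2 * (1 + C₀)) + n / 2
    + n / 2 * (2 / (1 - κ)) + 2 * n * (F₁ + 2 * F₂ * R) ^ 2 * (2 / κ)

/-- The constant that measures how fast the network reaches consensus. -/
noncomputable def consensusConst (n B : ℕ) (F₂ w : ℝ) : ℝ :=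
  (2 * n * F₂ + 1) * (n * B / w ^ (n * B))

theorem consensusConst_nonneg (n B : ℕ) (hF₂ : 0 ≤ F₂) (hw : 0 < w) :
    0 ≤ consensusConst n B F₂ w := by
  unfold consensusConst; positivity

theorem boundConst_nonneg {C₀ H : ℝ} (hR : 0 ≤ R) (hH : 0 ≤ H) (hC₀ : 0 ≤ C₀)
    (hκ0 : 0 < κ) (hκ1 : κ < 1) (hc1 : c < 1) : 0 ≤ boundConst n R F₁ F₂ κ c C₀ H := by
  have h1 : 0 < 1 - c := by linarith
  have h2 : 0 < 1 - κ := by linarith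
  unfold boundConst
  positivity

namespace Problem.IsRun

/-- Each term has a factor of at most order `1 + K²` and is dominated by a multiple of `Y = K²
T^(1-κ) + T^κ ≥ 1`. -/
theorem regret_add_violation_le_rpow (hn : 0 < n) (hw : 0 < w) (hκ0 : 0 < κ) (hκ1 : κ < 1)
    (hcκ : κ ≤ c) (hcκ' : 1 - κ ≤ c) (hc1 : c < 1)
    (hP : P.Regular R F₁ F₂) (hS : P.StronglyConvex μ) (hW : MixingNetwork G W w B)
    (h : P.IsRun W (fun t => 1 / (t : ℝ) ^ c) (fun t => 1 / (t : ℝ) ^ κ)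
      (fun t => 1 / (t : ℝ) ^ (1 - κ)) x q)
    {T : ℕ} (hT : 1 ≤ T) {C₀ : ℝ} (hC₀' : 0 ≤ C₀)
    (hC₀ : ∑ t ∈ Finset.Icc 1 T, max (((t + 1 : ℕ) : ℝ) ^ c - (t : ℝ) ^ c - μ) 0 ≤ C₀)
    {y : EuclideanSpace ℝ (Fin p)} (hy : y ∈ P.staticFeasible T)
    {q₀ : (i : Fin n) → EuclideanSpace ℝ (Fin (m i))}
    (hq₀ : ∀ i k, 0 ≤ q₀ i k) {K : ℝ} (hK : ∀ i, ‖q₀ i‖ ≤ K) :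
    ∑ t ∈ Finset.Icc 1 T, ∑ i, (P.globalLoss t (x i t) - P.globalLoss t y)
        + ∑ t ∈ Finset.Icc 1 T, ∑ i, inner ℝ (q₀ i) (posPart (P.g i t (x i t)))
        + K * ∑ t ∈ Finset.Icc 1 T, (spread fun i => x i t)
      ≤ boundConst n R F₁ F₂ κ c C₀ (consensusConst n B F₂ w)
        * (K ^ 2 * (T : ℝ) ^ (1 - κ) + (T : ℝ) ^ κ) := by
  have hF₂ := hP.subgrad_bound_nonneg ⟨0, hn⟩
  have hR := hP.radius_nonneg
  have hK0 : 0 ≤ K := (norm_nonneg _).trans (hK ⟨0, hn⟩)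
  have hmain := h.regret_add_violation_le hn hw hκ0 hP hS hW hC₀ hy hq₀ hK
    (H := consensusConst n B F₂ w) rfl
  have hH := consensusConst_nonneg n B hF₂ hw
  refine hmain.trans ?_
  unfold boundConst
  set H := consensusConst n B F₂ w
  have hT1 : (1 : ℝ) ≤ T := by exact_mod_cast hT
  have hα := sum_one_div_rpow_le (hκ0.le.trans hcκ) hc1 hT
  have hβ := sum_one_div_rpow_le hκ0.le hκ1 hT
  have hγ := sum_one_div_rpow_le (a := 1 - κ) (by linarith) (by linarith) hT
  rw [sub_sub_cancel] at hγ
  have hα1 : (T : ℝ) ^ (1 - c) ≤ (T : ℝ) ^ (1 - κ) :=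
    Real.rpow_le_rpow_of_exponent_le hT1 (by linarith)
  have hα2 : (T : ℝ) ^ (1 - c) ≤ (T : ℝ) ^ κ :=
    Real.rpow_le_rpow_of_exponent_le hT1 (by linarith)
  have hβ1 : 1 ≤ (T : ℝ) ^ (1 - κ) := Real.one_le_rpow hT1 (by linarith)
  have hγ1 : 1 ≤ (T : ℝ) ^ κ := Real.one_le_rpow hT1 hκ0.le
  set Sα := ∑ t ∈ Finset.Icc 1 T, 1 / ((t + 1 : ℕ) : ℝ) ^ c
  set Sβ := ∑ t ∈ Finset.Icc 1 T, 1 / ((t + 1 : ℕ) : ℝ) ^ κ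
  set Sγ := ∑ t ∈ Finset.Icc 1 T, 1 / ((t + 1 : ℕ) : ℝ) ^ (1 - κ)
  set Tα := (T : ℝ) ^ (1 - c)
  set Tβ := (T : ℝ) ^ (1 - κ)
  set Tγ := (T : ℝ) ^ κ
  set Y := K ^ 2 * Tβ + Tγ with hY
  have hc' : 0 < 1 - c := by linarith
  have hκ' : 0 < 1 - κ := by linarith
  have hK2 : 0 ≤ K ^ 2 := sq_nonneg K
  have hKβ : K ^ 2 ≤ K ^ 2 * Tβ := le_mul_of_one_le_right hK2 hβ1
  have hY1 : 1 ≤ Y := by linarith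
  have hY2 : K ^ 2 ≤ Y := by linarith
  have hY3 : K ^ 2 * Tβ ≤ Y := by linarith
  have hY4 : Tγ ≤ Y := by linarith
  have i1 : (1 + K) * (2 * R * H) ≤ 2 * (2 * R * H) * Y := by
    have h1 : 1 + K ≤ 2 * Y := by nlinarith [sq_nonneg (K - 1)]
    have := mul_le_mul_of_nonneg_right h1 (show 0 ≤ 2 * R * H by positivity)
    linarith
  have i2 : n * ((1 + K) * (F₂ + 2 * H)) ^ 2 / 2 * Sα
      ≤ n * (F₂ + 2 * H) ^ 2 * (2 / (1 - c)) * Y := by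
    -- Both lower bounds on `c` enter here: `T^(1-c) ≤ T^κ` for the constant part and `T^(1-c) ≤
    -- T^(1-κ)` for the part with `K²`.
    have h1 : (1 + K) ^ 2 * Tα ≤ 2 * Y := by
      have h2 : (1 + K) ^ 2 ≤ 2 + 2 * K ^ 2 := by nlinarith [sq_nonneg (K - 1)]
      have h3 : 0 ≤ Tα := Real.rpow_nonneg (by positivity) _
      have h4 := mul_le_mul_of_nonneg_right h2 h3
      have h5 := mul_le_mul_of_nonneg_left hα1 hK2
      linarith
    have h6 := mul_le_mul_of_nonneg_left hα
      (show 0 ≤ n * ((1 + K) * (F₂ + 2 * H)) ^ 2 / 2 by positivity)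
    have h7 := mul_le_mul_of_nonneg_left h1
      (show 0 ≤ n * (F₂ + 2 * H) ^ 2 * (2 / (1 - c)) / 2 by positivity)
    refine h6.trans ((le_of_eq ?_).trans (h7.trans (le_of_eq ?_))) <;> ring
  have i3 : n * (2 * R ^ 2 * (1 + C₀)) ≤ n * (2 * R ^ 2 * (1 + C₀)) * Y :=
    le_mul_of_one_le_right (by positivity) hY1
  have i4 : n * K ^ 2 / 2 ≤ n / 2 * Y := by
    have := mul_le_mul_of_nonneg_left hY2 (show 0 ≤ (n : ℝ) / 2 by positivity)
    linarith
  have i5 : n * K ^ 2 / 2 * Sβ ≤ n / 2 * (2 / (1 - κ)) * Y := by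
    have h6 := mul_le_mul_of_nonneg_left hβ (show 0 ≤ n * K ^ 2 / 2 by positivity)
    have h7 := mul_le_mul_of_nonneg_left hY3 (show 0 ≤ n / 2 * (2 / (1 - κ)) by positivity)
    refine h6.trans ((le_of_eq ?_).trans h7)
    ring
  have i6 : 2 * n * (F₁ + 2 * F₂ * R) ^ 2 * Sγ
      ≤ 2 * n * (F₁ + 2 * F₂ * R) ^ 2 * (2 / κ) * Y := by
    have h6 := mul_le_mul_of_nonneg_left (hγ.trans
      (mul_le_mul_of_nonneg_left hY4 (by positivity)))
      (show 0 ≤ 2 * n * (F₁ + 2 * F₂ * R) ^ 2 by positivity)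
    linarith
  linarith

end Problem.IsRun

/-- An optimal static decision exists by compactness. -/
theorem Problem.Regular.exists_isOptimalStatic (hn : 0 < n) (hP : P.Regular R F₁ F₂) {T : ℕ}
    (hne : (P.staticFeasible T).Nonempty) : ∃ y, P.IsOptimalStatic T y := by
  have hF₂ := hP.subgrad_bound_nonneg ⟨0, hn⟩
  have hcont : ∀ φ : EuclideanSpace ℝ (Fin p) → ℝ,
      (∀ y ∈ P.X, ∀ z ∈ P.X, φ y ≤ φ z + F₂ * ‖y - z‖) → ContinuousOn φ P.X := by
    intro φ hφ
    have : LipschitzOnWith F₂.toNNReal φ P.X := by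
      refine LipschitzOnWith.of_le_add_mul _ fun y hy z hz => ?_
      rw [Real.coe_toNNReal _ hF₂, dist_eq_norm]
      exact hφ y hy z hz
    exact this.continuousOn
  have hsub : P.staticFeasible T ⊆ P.X := fun y hy => hy.1
  have hclosed : IsClosed (P.staticFeasible T) := by
    -- The constraint functions are continuous only on `P.X`, so each sublevel set is intersected
    -- with `P.X` again.
    have e : P.staticFeasible T = P.X ∩ ⋂ t ∈ Finset.Icc 1 T, ⋂ s : Σ i, Fin (m i),
        P.X ∩ (fun y => P.g s.1 t y s.2) ⁻¹' Set.Iic 0 := by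
      ext y
      simp only [Problem.staticFeasible, Problem.globalConstraint, Set.mem_ofPred_eq,
        Set.mem_inter_iff, Set.mem_iInter, Set.mem_preimage, Set.mem_Iic]
      exact ⟨fun hy => ⟨hy.1, fun t ht s => ⟨hy.1, hy.2 t ht s⟩⟩,
        fun hy => ⟨hy.1, fun t ht s => (hy.2 t ht s).2⟩⟩
    rw [e]
    refine hP.closed.inter (isClosed_biInter fun t ht => isClosed_iInter fun s => ?_)
    exact (hcont _ fun y hy z hz => hP.constraint_le_add s.1 (Finset.mem_Icc.1 ht).1 hy hz
      s.2).preimage_isClosed_of_isClosed hP.closed isClosed_Iic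
  have hcompact : IsCompact (P.staticFeasible T) :=
    (isCompact_closedBall (0 : EuclideanSpace ℝ (Fin p)) R).of_isClosed_subset hclosed
      (hsub.trans hP.subset_ball)
  have hloss : ContinuousOn (fun y => ∑ t ∈ Finset.Icc 1 T, P.globalLoss t y)
      (P.staticFeasible T) := by
    refine continuousOn_finsetSum _ fun t ht => ContinuousOn.mul continuousOn_const
      (continuousOn_finsetSum _ fun j _ => ?_)
    exact (hcont _ fun y hy z hz =>
      hP.loss_le_add j (Finset.mem_Icc.1 ht).1 hy hz).mono hsub
  obtain ⟨y, hy, hmin⟩ := hcompact.exists_isMinOn hne hloss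
  exact ⟨y, hy, hmin⟩

theorem Problem.Regular.neg_le_globalLoss_sub (hn : 0 < n) (hP : P.Regular R F₁ F₂) {t : ℕ}
    (ht : 1 ≤ t) {y z : EuclideanSpace ℝ (Fin p)} (hy : y ∈ P.X) (hz : z ∈ P.X) :
    -F₁ ≤ P.globalLoss t y - P.globalLoss t z := by
  have hn' : (0 : ℝ) < n := by exact_mod_cast hn
  have h1 : ∑ _j : Fin n, -F₁ ≤ ∑ j, (P.f j t y - P.f j t z) :=
    Finset.sum_le_sum fun j _ => (abs_le.1 (hP.loss_bound j t ht y hy z hz)).1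
  have h2 := mul_le_mul_of_nonneg_left h1 (show 0 ≤ 1 / (n : ℝ) by positivity)
  unfold Problem.globalLoss
  rw [← mul_sub, ← Finset.sum_sub_distrib]
  refine le_trans (le_of_eq ?_) h2
  simp only [Finset.sum_const, Finset.card_univ, Fintype.card_fin, nsmul_eq_mul]
  field_simp

namespace Problem.IsRun

variable {α β γ : ℕ → ℝ}

/-- The violation of the stacked constraints in terms of the agents' own violations. -/
theorem netViolation_le (hn : 0 < n) (hP : P.Regular R F₁ F₂) (h : P.IsRun W α β γ x q)
    (T : ℕ) :
    P.netViolation x T ≤ ∑ t ∈ Finset.Icc 1 T, ∑ j, ‖posPart (P.g j t (x j t))‖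
      + n * F₂ * ∑ t ∈ Finset.Icc 1 T, (spread fun i => x i t) := by
  have hn' : (0 : ℝ) < n := by exact_mod_cast hn
  have h1 : ∀ i, ∑ t ∈ Finset.Icc 1 T, ‖posPart (P.globalConstraint t (x i t))‖
      ≤ ∑ t ∈ Finset.Icc 1 T, ∑ j, ‖posPart (P.g j t (x j t))‖
      + n * F₂ * ∑ t ∈ Finset.Icc 1 T, (spread fun i => x i t) := by
    intro i
    rw [Finset.mul_sum, ← Finset.sum_add_distrib]
    refine Finset.sum_le_sum fun t ht => ?_
    have ht1 := (Finset.mem_Icc.1 ht).1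
    refine (norm_le_sum_norm_blocks _).trans ?_
    have h2 : ∀ j, ‖posPart (P.g j t (x i t))‖
        ≤ ‖posPart (P.g j t (x j t))‖ + F₂ * spread fun i => x i t := fun j =>
      (hP.norm_posPart_constraint_le j ht1 (h.mem hP i ht1) (h.mem hP j ht1)).trans
        (add_le_add le_rfl (mul_le_mul_of_nonneg_left
          (norm_sub_le_spread (fun i => x i t) i j) (hP.subgrad_bound_nonneg j)))
    refine (Finset.sum_le_sum fun j _ => h2 j).trans (le_of_eq ?_)
    rw [Finset.sum_add_distrib]
    simp only [Finset.sum_const, Finset.card_univ, Fintype.card_fin, nsmul_eq_mul, mul_assoc]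
  have h3 := mul_le_mul_of_nonneg_left (Finset.sum_le_sum fun i (_ : i ∈ Finset.univ) => h1 i)
    (show 0 ≤ 1 / (n : ℝ) by positivity)
  refine h3.trans (le_of_eq ?_)
  simp only [Finset.sum_const, Finset.card_univ, Fintype.card_fin, nsmul_eq_mul]
  field_simp

end Problem.IsRun

/-- Equal weights `K / M` serve as the dual comparator for the violation: paired with a nonnegative
vector they give a multiple of its `ℓ¹` norm, and the same comparator works in every round. -/
theorem norm_toLp_const_le {d M : ℕ} {K : ℝ} (hK : 0 ≤ K) (hdM : d ≤ M) :
    ‖(WithLp.toLp 2 fun _ => K / M : EuclideanSpace ℝ (Fin d))‖ ≤ K := by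
  refine (norm_le_sum_abs _).trans ?_
  simp only [Finset.sum_const, Finset.card_univ, Fintype.card_fin, nsmul_eq_mul,
    abs_of_nonneg (show 0 ≤ K / (M : ℝ) by positivity)]
  rcases Nat.eq_zero_or_pos M with rfl | hM
  · simpa using hK
  · have h1 : (d : ℝ) ≤ M := by exact_mod_cast hdM
    have h2 : (0 : ℝ) < M := by exact_mod_cast hM
    rw [mul_div_assoc', div_le_iff₀ h2, mul_comm]
    exact mul_le_mul_of_nonneg_left h1 hK

theorem div_mul_norm_le_inner_toLp_const {d M : ℕ} {K : ℝ} (hK : 0 ≤ K)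
    {v : EuclideanSpace ℝ (Fin d)} (hv : ∀ k, 0 ≤ v k) :
    K / M * ‖v‖ ≤ inner ℝ (WithLp.toLp 2 fun _ => K / M : EuclideanSpace ℝ (Fin d)) v := by
  refine (mul_le_mul_of_nonneg_left (norm_le_sum_abs v)
    (show 0 ≤ K / (M : ℝ) by positivity)).trans (le_of_eq ?_)
  simp only [PiLp.inner_apply, RCLike.inner_apply, conj_trivial, Finset.mul_sum]
  refine Finset.sum_congr rfl fun k _ => ?_
  rw [abs_of_nonneg (hv k), mul_comm]

end Bounds

end OnlineOpt

/-! ### Choice of comparators and conclusion -/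

/-- The constant `C` depends only on the numbers quantified before it. -/
theorem mainTheorem3 (n : ℕ) (hn : 0 < n) (m : Fin n → ℕ) (hm : ∀ i, 0 < m i)
    (R F₁ F₂ μ w κ c : ℝ) (B : ℕ)
    (hμ : 0 < μ) (hw : w ∈ Set.Ioo (0 : ℝ) 1) (hB : 0 < B)
    (hκ : κ ∈ Set.Ioo (0 : ℝ) 1) (hc : c ∈ Set.Ico (max κ (1 - κ)) 1) :
    ∃ C : ℝ, ∀ (p : ℕ) (P : OnlineOpt.Problem n m p)
      (G : ℕ → Digraph (Fin n)) (W : ℕ → Matrix (Fin n) (Fin n) ℝ)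
      (x : Fin n → ℕ → EuclideanSpace ℝ (Fin p))
      (q : (i : Fin n) → ℕ → EuclideanSpace ℝ (Fin (m i))),
      0 < p →
      P.Regular R F₁ F₂ →
      P.StronglyConvex μ →
      (∀ T ≥ 1, (P.staticFeasible T).Nonempty) →
      OnlineOpt.MixingNetwork G W w B →
      P.IsRun W (fun t => 1 / (t : ℝ) ^ c) (fun t => 1 / (t : ℝ) ^ κ)
        (fun t => 1 / (t : ℝ) ^ (1 - κ)) x q →
      ∀ T : ℕ, 1 ≤ T →
        (∃ y, P.IsOptimalStatic T y) ∧
        (∀ y, P.IsOptimalStatic T y → P.netReg x (fun _ => y) T ≤ C * (T : ℝ) ^ κ) ∧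
        P.netViolation x T ≤ C * (T : ℝ) ^ (1 - κ / 2) := by
  obtain ⟨hκ0, hκ1⟩ := hκ
  obtain ⟨hc0, hc1⟩ := hc
  have hcκ : κ ≤ c := (le_max_left _ _).trans hc0
  have hcκ' : 1 - κ ≤ c := (le_max_right _ _).trans hc0
  obtain ⟨C₀, hC₀', hC₀⟩ := OnlineOpt.exists_sum_max_rpow_sub_le (hκ0.le.trans hcκ) hc1 hμ
  set H := OnlineOpt.consensusConst n B F₂ w with hHdef
  set A := OnlineOpt.boundConst n R F₁ F₂ κ c C₀ H with hAdef
  set M := ∑ i, m i with hM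
  -- `A` serves the regret. In the other constant, `n * F₁ + 2 * A` comes from the joint estimate
  -- and `M + n * F₂` from passing to stacked violations.
  refine ⟨max A ((M + n * F₂) * (n * F₁ + 2 * A)), ?_⟩
  intro p P G W x q _ hP hS hfeas hW hrun T hT
  have hn' : (1 : ℝ) ≤ n := by exact_mod_cast hn
  have hT1 : (1 : ℝ) ≤ T := by exact_mod_cast hT
  have hT0 : (0 : ℝ) < T := by linarith
  have hF₁ := hP.bound_nonneg ⟨0, hn⟩
  have hF₂ := hP.subgrad_bound_nonneg ⟨0, hn⟩
  have hH : 0 ≤ H := OnlineOpt.consensusConst_nonneg n B hF₂ hw.1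
  have hA : 0 ≤ A := OnlineOpt.boundConst_nonneg hP.radius_nonneg hH hC₀' hκ0 hκ1 hc1
  have hbound := fun {y : EuclideanSpace ℝ (Fin p)} (hy : y ∈ P.staticFeasible T)
      {q₀ : (i : Fin n) → EuclideanSpace ℝ (Fin (m i))} (hq₀ : ∀ i k, 0 ≤ q₀ i k) {K : ℝ}
      (hK : ∀ i, ‖q₀ i‖ ≤ K) =>
    hrun.regret_add_violation_le_rpow hn hw.1 hκ0 hκ1 hcκ hcκ' hc1 hP hS hW hT hC₀' (hC₀ T)
      hy hq₀ hK
  simp only [← hHdef, ← hAdef] at hbound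
  refine ⟨hP.exists_isOptimalStatic hn (hfeas T hT), fun y hy => ?_, ?_⟩
  · have h1 := hbound hy.1 (q₀ := fun i => 0) (by simp) (K := 0) (by simp)
    simp only [inner_zero_left, Finset.sum_const_zero, zero_mul, add_zero, zero_add,
      ne_eq, OfNat.ofNat_ne_zero, not_false_eq_true, zero_pow] at h1
    have hTκ : 0 ≤ (T : ℝ) ^ κ := by positivity
    have h2 : P.netReg x (fun _ => y) T = 1 / n * ∑ t ∈ Finset.Icc 1 T, ∑ i,
        (P.globalLoss t (x i t) - P.globalLoss t y) := by
      unfold OnlineOpt.Problem.netReg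
      rw [Finset.sum_comm]
      simp only [Finset.sum_sub_distrib, Finset.sum_const, Finset.card_univ, Fintype.card_fin,
        nsmul_eq_mul, ← Finset.mul_sum]
      field_simp
    rw [h2]
    calc _ ≤ 1 / n * (A * (T : ℝ) ^ κ) := mul_le_mul_of_nonneg_left h1 (by positivity)
      _ ≤ 1 * (A * (T : ℝ) ^ κ) := mul_le_mul_of_nonneg_right
          ((div_le_one (by linarith)).2 hn') (by positivity)
      _ ≤ _ := by
          rw [one_mul]
          exact mul_le_mul_of_nonneg_right (le_max_left _ _) hTκ
  · obtain ⟨y, hy⟩ := hfeas T hT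
    -- This choice makes `K² T^(1-κ) = T` and `T / K = T^(1-κ/2)`.
    set K := (T : ℝ) ^ (κ / 2) with hKdef
    have hK : 0 < K := Real.rpow_pos_of_pos hT0 _
    have hmM : ∀ i, m i ≤ M := fun i =>
      Finset.single_le_sum (f := m) (fun _ _ => Nat.zero_le _) (Finset.mem_univ i)
    have hM0 : (0 : ℝ) < M := by exact_mod_cast (hm ⟨0, hn⟩).trans_le (hmM _)
    have h1 := hbound hy (q₀ := fun i => WithLp.toLp 2 fun _ => K / M)
      (fun i k => by simp only; positivity)
      (fun i => OnlineOpt.norm_toLp_const_le hK.le (hmM i))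
    -- The loss gap may be negative, but by no more than `F₁` per agent and round.
    have h2 : ∑ t ∈ Finset.Icc 1 T, ∑ _i : Fin n, -F₁ ≤ ∑ t ∈ Finset.Icc 1 T, ∑ i,
        (P.globalLoss t (x i t) - P.globalLoss t y) :=
      Finset.sum_le_sum fun t ht => Finset.sum_le_sum fun i _ =>
        hP.neg_le_globalLoss_sub hn (Finset.mem_Icc.1 ht).1
          (hrun.mem hP i (Finset.mem_Icc.1 ht).1) hy.1
    simp only [Finset.sum_const, Finset.card_univ, Fintype.card_fin, nsmul_eq_mul,
      Nat.card_Icc, Nat.add_sub_cancel] at h2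
    have h3 : K / M * ∑ t ∈ Finset.Icc 1 T, ∑ i, ‖OnlineOpt.posPart (P.g i t (x i t))‖
        ≤ ∑ t ∈ Finset.Icc 1 T, ∑ i, inner ℝ
          (WithLp.toLp 2 fun _ => K / M : EuclideanSpace ℝ (Fin (m i)))
          (OnlineOpt.posPart (P.g i t (x i t))) := by
      simp only [Finset.mul_sum]
      exact Finset.sum_le_sum fun t _ => Finset.sum_le_sum fun i _ =>
        OnlineOpt.div_mul_norm_le_inner_toLp_const hK.le (OnlineOpt.posPart_nonneg _)
    have h4 := hrun.netViolation_le hn hP T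
    set V := ∑ t ∈ Finset.Icc 1 T, ∑ i, ‖OnlineOpt.posPart (P.g i t (x i t))‖
    set D := ∑ t ∈ Finset.Icc 1 T, (OnlineOpt.spread fun i => x i t)
    have hV : 0 ≤ V := Finset.sum_nonneg fun t _ => Finset.sum_nonneg fun i _ => norm_nonneg _
    have hD : 0 ≤ D := Finset.sum_nonneg fun t _ => OnlineOpt.spread_nonneg _
    have h5 : K ^ 2 * (T : ℝ) ^ (1 - κ) = T := by
      rw [hKdef, ← Real.rpow_natCast, ← Real.rpow_mul hT0.le, ← Real.rpow_add hT0]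
      norm_num
    have h6 : (T : ℝ) ^ κ ≤ T := by
      simpa using Real.rpow_le_rpow_of_exponent_le hT1 hκ1.le
    have h7 : K * (T : ℝ) ^ (1 - κ / 2) = T := by
      rw [hKdef, ← Real.rpow_add hT0]
      norm_num
    rw [h5] at h1
    have h8 : V / M + D ≤ (n * F₁ + 2 * A) * (T : ℝ) ^ (1 - κ / 2) := by
      refine le_of_mul_le_mul_left ?_ hK
      have h9 : K * ((n * F₁ + 2 * A) * (T : ℝ) ^ (1 - κ / 2)) = (n * F₁ + 2 * A) * T := by
        rw [mul_left_comm, h7]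
      have h10 : K * (V / M + D) = K / M * V + K * D := by ring
      have h11 := mul_le_mul_of_nonneg_left h6 hA
      rw [h9, h10]
      linarith
    -- The joint estimate controls `V / M + D`; the extra cross terms on the right are nonnegative.
    have h12 : V + n * F₂ * D ≤ (M + n * F₂) * (V / M + D) := by
      have e : (M + n * F₂) * (V / M + D) = V + n * F₂ * D + (n * F₂ * (V / M) + M * D) := by
        field_simp
        ring
      have : 0 ≤ n * F₂ * (V / M) + M * D := by positivity
      linarith
    calc P.netViolation x T ≤ (M + n * F₂) * (V / M + D) := h4.trans h12
      _ ≤ (M + n * F₂) * ((n * F₁ + 2 * A) * (T : ℝ) ^ (1 - κ / 2)) :=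
          mul_le_mul_of_nonneg_left h8 (by positivity)
      _ = (M + n * F₂) * (n * F₁ + 2 * A) * (T : ℝ) ^ (1 - κ / 2) := by ring
      _ ≤ _ := mul_le_mul_of_nonneg_right (le_max_right _ _) (by positivity)
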